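/- Conventions. A $3$-manifold is connected, smooth, compact, orientable, and every component of its (possibly empty) boundary is a torus. Let $N$ be a $3$-manifold with a CW-structure and write $\pi=\pi_1(N)$; then $\pi$ acts on the left on the universal cover $\tilde N$ by deck transformations, and $C_*(N)$ denotes the cellular chain complex of $\tilde N$ with the induced CW-structure, a complex of free left $\mathbb Z[\pi]$-modules with a basis given by a choice of one lift of each cell of $N$ (a fundamental family). For a field $K$, a finite-dimensional $K$-vector space $W$ with a linear right $\pi$-action, and $\theta\in H^1(N;\mathbb Z)=\operatorname{Hom}(\pi,\mathbb Z)$, let $W_\theta:=K(t)\otimes_K W$ with the right $\pi$-action $(z\otimes w)\cdot g:=z\,t^{\theta(g)}\otimes w\cdot g$. The twisted Reidemeister torsion $\tau(N;W_\theta)\in K(t)$ is defined to be $0$ if $W_\theta\otimes_{\mathbb Z[\pi]}C_*(N)$ is not acyclic. If it is acyclic, choose bases of the images $\operatorname{Im}\partial_i$, let $b_i$ be the basis of the $i$-th chain space formed by the chosen basis of $\operatorname{Im}\partial_{i+1}$ and a lift of the chosen basis of $\operatorname{Im}\partial_i$, let $c_i$ be the basis given by a fundamental family and a $K$-basis of $W$,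 and put \[ \tau(N;W_\theta):=\prod_i \det[b_i/c_i]^{(-1)^i}\in K(t)\setminus\{0\}. \] For a non-zero Laurent polynomial $f=\sum_{i=k}^{l}a_it^i$ with $a_k,a_l\neq 0$ put $\operatorname{width} f:=l-k$; put $\operatorname{width}(f/g):=\operatorname{width}f-\operatorname{width}g$ and $\operatorname{width}0:=0$. Statement. Let $N$ be a $3$-manifold, let $\theta\in H^1(N;\mathbb Z)$ be non-trivial, and let $V$ be a finitely generated free abelian group with a linear right action of $\pi_1(N)$. Put $V^{\mathbb C}:=\mathbb C\otimes_{\mathbb Z}V$ and, for a prime $p$, $V^p:=\mathbb F_p\otimes_{\mathbb Z}V$. Then for all but finitely many primes $p$ \[ \operatorname{width}\,\tau(N;V^p_\theta)=\operatorname{width}\,\tau(N;V^{\mathbb C}_\theta), \] for any choices made in the computation of the two torsions. -/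

import Mathlib

open Set Metric Topology TensorProduct
open scoped Manifold ContDiff

noncomputable section

/-! ### Three-manifolds -/

/-- A smooth three-manifold (with possibly empty boundary) is orientable if it is covered by
smooth charts all of whose transition maps have positive Jacobian determinant. -/
def IsOrientableThreeManifold (N : Type*) [TopologicalSpace N]
    [ChartedSpace (EuclideanHalfSpace 3) N] : Prop :=
  ∃ A : Set (OpenPartialHomeomorph N (EuclideanHalfSpace 3)),
    A ⊆ IsManifold.maximalAtlas (𝓡∂ 3) ∞ N ∧
    (∀ x : N, ∃ φ ∈ A, x ∈ φ.source) ∧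
    ∀ φ ∈ A, ∀ ψ ∈ A, ∀ x ∈ φ.source ∩ ψ.source,
      0 < (fderivWithin ℝ (ψ.extend (𝓡∂ 3) ∘ (φ.extend (𝓡∂ 3)).symm) (range (𝓡∂ 3))
        (φ.extend (𝓡∂ 3) x)).det

/-- Every component of the boundary is a torus. The boundary may be empty. -/
def HasToroidalBoundary (N : Type*) [TopologicalSpace N]
    [ChartedSpace (EuclideanHalfSpace 3) N] : Prop :=
  ∀ x ∈ (𝓡∂ 3).boundary N,
    Nonempty (connectedComponentIn ((𝓡∂ 3).boundary N) x ≃ₜ Circle × Circle)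

/-! ### Compact CW complexes have finitely many cells -/

theorem finite_cells_of_compactSpace (N : Type*) [TopologicalSpace N] [T2Space N] [CompactSpace N]
    [CWComplex (univ : Set N)] :
    Finite (Σ n, RelCWComplex.cell (univ : Set N) n) := by
  classical
  let x : (Σ n, RelCWComplex.cell (univ : Set N) n) → N := fun c => RelCWComplex.map c.1 c.2 0
  have hx : ∀ c, x c ∈ RelCWComplex.openCell c.1 c.2 := fun c =>
    ⟨0, by simp, rfl⟩
  have hinj : Function.Injective x := by
    intro c d h
    by_contra hne
    exact Set.disjoint_left.1 (RelCWComplex.disjoint_openCell_of_ne (by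
      intro h'; exact hne (by simpa using h'))) (hx c) (h ▸ hx d)
  have hfin : ∀ (A : Set N), A ⊆ range x → ∀ n (j : RelCWComplex.cell (univ : Set N) n),
      (A ∩ RelCWComplex.openCell n j).Finite := by
    intro A hA n j
    refine (Set.finite_singleton (x ⟨n, j⟩)).subset ?_
    rintro y ⟨hyA, hy⟩
    obtain ⟨c, rfl⟩ := hA hyA
    by_contra hne
    refine Set.disjoint_left.1 (RelCWComplex.disjoint_openCell_of_ne (n := c.1) (i := c.2)
      (m := n) (j := j) ?_) (hx c) hy
    intro h'
    exact hne (by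
      have : c = ⟨n, j⟩ := h'
      rw [this]; rfl)
  have hclosed : ∀ (A : Set N), A ⊆ range x → IsClosed A := by
    intro A hA
    refine CWComplex.closed' A (C := univ) (subset_univ _) fun n j => ?_
    refine Set.Finite.isClosed ?_
    change (A ∩ RelCWComplex.closedCell (C := (univ : Set N)) n j).Finite
    rw [← RelCWComplex.cellFrontier_union_openCell_eq_closedCell, inter_union_distrib_left]
    refine Set.Finite.union ?_ (hfin A hA n j)
    obtain ⟨I, hI⟩ := CWComplex.cellFrontier_subset_finite_openCell n j
    refine Set.Finite.subset ?_ (inter_subset_inter_right A hI)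
    simp only [inter_iUnion]
    refine (Set.finite_lt_nat n).biUnion fun m _ => ?_
    exact (I m).finite_toSet.biUnion fun k _ => hfin A hA m k
  have hdisc : IsDiscrete (range x) := by
    refine ⟨discreteTopology_iff_forall_isClosed.2 fun s => ?_⟩
    have := (hclosed (Subtype.val '' s) (by simp)).preimage
      (continuous_subtype_val (p := (· ∈ range x)))
    rwa [preimage_image_eq _ Subtype.val_injective] at this
  have : (range x).Finite := (hclosed _ subset_rfl).isCompact.finite hdisc
  exact (Set.finite_range_iff hinj).1 this

instance instFintypeCellOfCompactSpace (N : Type*) [TopologicalSpace N] [T2Space N]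
    [CompactSpace N] [CWComplex (univ : Set N)] (n : ℕ) :
    Fintype (RelCWComplex.cell (univ : Set N) n) :=
  haveI := finite_cells_of_compactSpace N
  haveI : Finite (RelCWComplex.cell (univ : Set N) n) :=
    Finite.of_injective (β := Σ n, RelCWComplex.cell (univ : Set N) n) (Sigma.mk n)
      sigma_mk_injective
  Fintype.ofFinite _

/-! ### Coverings, deck transformations and fundamental families -/

section Covering

variable {N E : Type*} [TopologicalSpace N] [TopologicalSpace E]

/-- The group of deck transformations of `p : E → N`, acting on `E` from the left. -/
def Deck (p : E → N) : Subgroup (E ≃ₜ E) where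
  carrier := {h | ∀ x, p (h x) = p x}
  mul_mem' {a b} ha hb x := (ha (b x)).trans (hb x)
  one_mem' _ := rfl
  inv_mem' {a} ha x := by
    have := ha (a.symm x)
    rw [Homeomorph.apply_symm_apply] at this
    exact this.symm

/-- The identification of deck transformations with elements of the fundamental group: for a
simply connected covering, `g` is sent to the class of the image in `N` of a path from `e₀` to
`g e₀`. It is multiplicative for the product "first `γ`, then `δ`" of loops, which is `δ * γ` in
the convention of Mathlib. -/
def deckLoop [SimplyConnectedSpace E] {p : E → N} (hp : IsCoveringMap p) (e₀ : E)
    (g : Deck p) : FundamentalGroup N (p e₀) :=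
  FundamentalGroup.fromPath (Path.Homotopic.Quotient.mk
    (((PathConnectedSpace.somePath e₀ (g.1 e₀)).map hp.continuous).cast rfl (g.2 e₀).symm))

variable [CWComplex (univ : Set N)]

/-- A fundamental family: for each cell of `N` one lift to `E` of the cell, that is, of its
characteristic map (only the values on the closed unit ball matter). The cells of the induced
CW structure on the universal covering are the translates of these by deck transformations. -/
structure FundamentalFamily (p : E → N) where
  lift (n : ℕ) (c : RelCWComplex.cell (univ : Set N) n) : (Fin n → ℝ) → E
  continuousOn (n : ℕ) (c : RelCWComplex.cell (univ : Set N) n) :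
    ContinuousOn (lift n c) (closedBall 0 1)
  lifts (n : ℕ) (c : RelCWComplex.cell (univ : Set N) n) :
    ∀ x ∈ closedBall (0 : Fin n → ℝ) 1, p (lift n c x) = RelCWComplex.map n c x

open scoped Classical in
/-- The map that collapses the complement of the open cell `g · c̃` of dimension `m` in the
`m`-skeleton of `E` to a point, where the open unit ball is identified with `ℝ ^ m`. -/
def FundamentalFamily.collapse {p : E → N} (Φ : FundamentalFamily p) {m : ℕ}
    (c : RelCWComplex.cell (univ : Set N) m) (g : Deck p) (y : E) : OnePoint (Fin m → ℝ) :=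
  if h : ∃ x ∈ ball (0 : Fin m → ℝ) 1, g.1 (Φ.lift m c x) = y then
    (((1 - ‖h.choose‖)⁻¹ • h.choose : Fin m → ℝ) : OnePoint (Fin m → ℝ))
  else OnePoint.infty

/-- The standard sphere of dimension `m`. -/
abbrev StdSphere (m : ℕ) : Type := sphere (0 : EuclideanSpace ℝ (Fin (m + 1))) 1

open scoped Classical in
/-- The degree of a continuous self-map of the sphere of dimension `m ≥ 1`: the integer by which
it acts on the singular homology group in degree `m` with integral coefficients. -/
def sphereDegree (m : ℕ) (f : StdSphere m → StdSphere m) : ℤ :=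
  if h : ∃ hf : Continuous f, ∃ d : ℤ,
    (((AlgebraicTopology.singularHomologyFunctor (ModuleCat.{0} ℤ) m).obj (ModuleCat.of ℤ ℤ)).map
      (TopCat.ofHom ⟨f, hf⟩)) = d • CategoryTheory.CategoryStruct.id
        (((AlgebraicTopology.singularHomologyFunctor (ModuleCat.{0} ℤ) m).obj
          (ModuleCat.of ℤ ℤ)).obj (TopCat.of (StdSphere m)))
  then h.choose_spec.choose else 0

/-- The attaching map of the chosen lift of the `(m + 1)`-cell `c`, followed by the collapse onto
the cell `g · d̃` of dimension `m`, as a self-map of the sphere of dimension `m`. The boundary of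
the cube `[-1, 1] ^ (m + 1)` is parametrized by the round sphere via radial projection. -/
def FundamentalFamily.attachingMap {p : E → N} (Φ : FundamentalFamily p) {m : ℕ}
    (c : RelCWComplex.cell (univ : Set N) (m + 1)) (d : RelCWComplex.cell (univ : Set N) m)
    (g : Deck p) (u : StdSphere m) : StdSphere m :=
  onePointEquivSphereOfFinrankEq (ι := Fin (m + 1)) (V := Fin m → ℝ) (by simp)
    (Φ.collapse d g (Φ.lift (m + 1) c (‖WithLp.ofLp u.1‖⁻¹ • WithLp.ofLp u.1)))

open scoped Classical in
/-- The incidence number of the lift `c̃` of an `(m + 1)`-cell with the cell `g · d̃`, that is, the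
coefficient of `g · d̃` in the cellular boundary of `c̃`. For `m = 0` the boundary of a 1-cell is
its end point minus its initial point, for `m ≥ 1` it is given by degrees of attaching maps. -/
def FundamentalFamily.incidence {p : E → N} (Φ : FundamentalFamily p) {m : ℕ}
    (c : RelCWComplex.cell (univ : Set N) (m + 1)) (d : RelCWComplex.cell (univ : Set N) m)
    (g : Deck p) : ℤ :=
  if m = 0 then
    (if Φ.lift (m + 1) c 1 = g.1 (Φ.lift m d 0) then 1 else 0) -
      (if Φ.lift (m + 1) c (-1) = g.1 (Φ.lift m d 0) then 1 else 0)
  else sphereDegree m (Φ.attachingMap c d g)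

/-- Fundamental families exist. -/
theorem nonempty_fundamentalFamily [PathConnectedSpace N] [Nonempty E] {p : E → N}
    (hp : IsCoveringMap p) : Nonempty (FundamentalFamily p) := by
  have hsurj : Function.Surjective p := by
    intro x
    obtain ⟨e₀⟩ := ‹Nonempty E›
    let γ := PathConnectedSpace.somePath (p e₀) x
    refine ⟨hp.liftPath γ e₀ γ.source 1, ?_⟩
    have := congrFun (hp.liftPath_lifts γ e₀ γ.source) 1
    simpa using this
  have key : ∀ (n : ℕ) (c : RelCWComplex.cell (univ : Set N) n), ∃ l : (Fin n → ℝ) → E,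
      ContinuousOn l (closedBall 0 1) ∧
        ∀ x ∈ closedBall (0 : Fin n → ℝ) 1, p (l x) = RelCWComplex.map n c x := by
    intro n c
    let r : (Fin n → ℝ) → (Fin n → ℝ) := fun x => (max 1 ‖x‖)⁻¹ • x
    have hr : Continuous r := by
      refine ((continuous_const.max continuous_norm).inv₀ fun x => ?_).smul continuous_id
      positivity
    have hrmem : ∀ x, r x ∈ closedBall (0 : Fin n → ℝ) 1 := by
      intro x
      have h0 : (0 : ℝ) < max 1 ‖x‖ := by positivity
      rw [mem_closedBall_zero_iff, norm_smul, norm_inv, Real.norm_of_nonneg h0.le,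
        inv_mul_le_iff₀ h0, mul_one]
      exact le_max_right _ _
    have hcont : Continuous fun x => RelCWComplex.map n c (r x) :=
      (RelCWComplex.continuousOn n c).comp_continuous hr hrmem
    obtain ⟨e, he⟩ := hsurj (RelCWComplex.map n c (r 0))
    obtain ⟨l, ⟨-, hl⟩, -⟩ := hp.existsUnique_continuousMap_lifts ⟨_, hcont⟩ (0 : Fin n → ℝ) e he
    refine ⟨l, l.continuous.continuousOn, fun x hx => ?_⟩
    have h1 : r x = x := by
      have : max 1 ‖x‖ = 1 := max_eq_left (by simpa using hx)
      simp [r, this]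
    have h2 := congrFun hl x
    simpa [h1] using h2
  choose l hl hl' using key
  exact ⟨⟨l, hl, hl'⟩⟩

variable [SimplyConnectedSpace E]

/-- The matrix entry of the cellular boundary operator of the universal covering, with respect to
the `ℤ[π₁(N)]`-bases given by a fundamental family: the element `∑ g, [c̃ : g · d̃] g` of the group
ring (as a finitely supported function on the group). Only finitely many summands are non-zero,
since the boundary of `c̃` is compact. -/
def FundamentalFamily.boundaryEntry {p : E → N} (hp : IsCoveringMap p) (e₀ : E)
    (Φ : FundamentalFamily p) {m : ℕ} (c : RelCWComplex.cell (univ : Set N) (m + 1))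
    (d : RelCWComplex.cell (univ : Set N) m) : FundamentalGroup N (p e₀) →₀ ℤ :=
  ∑ᶠ g : Deck p, Finsupp.single (deckLoop hp e₀ g) (Φ.incidence c d g)

variable [T2Space N] [CompactSpace N]

/-- The boundary operator of the twisted chain complex `A ⊗_{ℤ[π₁(N)]} C(N)` over a field `F`.

`A` is an `F`-vector space with a linear right action of `π₁(N)`, given by
`v · γ = σ γ v`. (In Mathlib the product `γ * δ` in the fundamental group is "first `δ`, then `γ`",
so a monoid homomorphism `σ` to the endomorphisms is a right action of the fundamental group with
the product "first `γ`, then `δ`" that is used here.)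

As `C(N)` is free on the chosen lifts of cells, the chain module in degree `i` is the direct sum
over the `i`-cells of copies `A ⊗ c̃` of `A`, and
`∂ (v ⊗ c̃) = ∑ d, ∑ g, [c̃ : g · d̃] (v · g) ⊗ d̃`. -/
def FundamentalFamily.twistedBoundary {p : E → N} (hp : IsCoveringMap p) (e₀ : E)
    (Φ : FundamentalFamily p) {F A : Type*} [Field F] [AddCommGroup A] [Module F A]
    (σ : Representation F (FundamentalGroup N (p e₀)) A) (i : ℕ) :
    (RelCWComplex.cell (univ : Set N) (i + 1) → A) →ₗ[F]
      (RelCWComplex.cell (univ : Set N) i → A) :=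
  LinearMap.pi fun d => ∑ c : RelCWComplex.cell (univ : Set N) (i + 1),
    ((Φ.boundaryEntry hp e₀ c d).sum fun γ n => n • σ γ) ∘ₗ LinearMap.proj c

end Covering

/-! ### Torsion of a based chain complex -/

section Torsion

variable {F : Type*} [Field F] {M : ℕ → Type*} [∀ i, AddCommGroup (M i)] [∀ i, Module F (M i)]
  {κ : ℕ → Type*}

/-- Acyclicity of `⋯ → M 2 → M 1 → M 0 → 0`, where `d i : M (i + 1) → M i`. -/
def IsAcyclicComplex (d : ∀ i, M (i + 1) →ₗ[F] M i) : Prop :=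
  Function.Surjective (d 0) ∧ ∀ i, Function.Exact (d (i + 1)) (d i)

/-- The choices in the definition of the torsion of an acyclic complex with bases indexed by `κ i`:
bases of the images of the boundary operators, lifts of these bases, and orderings, so that the
basis of `im (d i)` and the lift of the basis of `im (d (i - 1))` together form a basis of `M i`
that can be compared with the given one. -/
structure TorsionChoices (κ : ℕ → Type*) (d : ∀ i, M (i + 1) →ₗ[F] M i) where
  rank : ℕ → ℕ
  imageBasis (i : ℕ) : Module.Basis (Fin (rank i)) F (LinearMap.range (d i))
  lift (i : ℕ) : Fin (rank i) → M (i + 1)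
  d_lift (i : ℕ) (j : Fin (rank i)) : d i (lift i j) = imageBasis i j
  indexZero : κ 0 ≃ Fin (rank 0)
  index (i : ℕ) : κ (i + 1) ≃ Fin (rank (i + 1)) ⊕ Fin (rank i)

variable [∀ i, Fintype (κ i)]

open scoped Classical in
/-- The alternating product `∏ i, det [b i / c i] ^ ((-1) ^ i)`. -/
def TorsionChoices.value {d : ∀ i, M (i + 1) →ₗ[F] M i} (c : ∀ i, Module.Basis (κ i) F (M i))
    (T : TorsionChoices κ d) : F :=
  (c 0).det (fun k => (T.imageBasis 0 (T.indexZero k) : M 0)) *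
    ∏ᶠ i : ℕ, (c (i + 1)).det (fun k =>
      Sum.elim (fun j => (T.imageBasis (i + 1) j : M (i + 1))) (T.lift i) (T.index i k)) ^
        ((-1 : ℤ) ^ (i + 1))

/-- `τ` is a value of the Reidemeister torsion of the complex with bases `c i`. For an acyclic
complex it is defined up to sign; it is zero if the complex is not acyclic. -/
def IsTorsionOfComplex (c : ∀ i, Module.Basis (κ i) F (M i)) (d : ∀ i, M (i + 1) →ₗ[F] M i)
    (τ : F) : Prop :=
  (IsAcyclicComplex d ∧ ∃ T : TorsionChoices κ d, τ = T.value c) ∨ (¬ IsAcyclicComplex d ∧ τ = 0)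

/-- Every complex with finite bases has a torsion. -/
theorem exists_isTorsionOfComplex (c : ∀ i, Module.Basis (κ i) F (M i))
    (d : ∀ i, M (i + 1) →ₗ[F] M i) : ∃ τ : F, IsTorsionOfComplex c d τ := by
  by_cases h : IsAcyclicComplex d
  swap
  · exact ⟨0, .inr ⟨h, rfl⟩⟩
  have hfin : ∀ i, Module.Finite F (M i) := fun i => Module.Finite.of_basis (c i)
  let β : ∀ i, Module.Basis (Fin (Module.finrank F (LinearMap.range (d i)))) F
      (LinearMap.range (d i)) := fun i => Module.finBasis F _
  choose l hl using fun i (j : Fin (Module.finrank F (LinearMap.range (d i)))) => (β i j).2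
  have h0 : Fintype.card (κ 0) = Module.finrank F (LinearMap.range (d 0)) := by
    rw [← Module.finrank_eq_card_basis (c 0), LinearMap.range_eq_top.2 h.1, finrank_top]
  have h1 : ∀ i, Fintype.card (κ (i + 1)) = Module.finrank F (LinearMap.range (d (i + 1))) +
      Module.finrank F (LinearMap.range (d i)) := by
    intro i
    rw [← Module.finrank_eq_card_basis (c (i + 1)), ← LinearMap.finrank_range_add_finrank_ker (d i),
      (LinearMap.exact_iff.1 (h.2 i)), add_comm]
  exact ⟨_, .inl ⟨h, ⟨_, β, l, hl, Fintype.equivFinOfCardEq h0,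
    fun i => (Fintype.equivFinOfCardEq (h1 i)).trans finSumFinEquiv.symm⟩, rfl⟩⟩

end Torsion

/-! ### Twisted torsion and its width -/

/-- The twisting module `W_θ = K(t) ⊗ W` with right action
`(z ⊗ v) · γ = z t ^ ⟨θ, γ⟩ ⊗ v · γ`. -/
def twistingModule {K W G : Type*} [Field K] [AddCommGroup W] [Module K W] [Group G]
    (θ : G →* Multiplicative ℤ) (σ : Representation K G W) :
    Representation (RatFunc K) G (RatFunc K ⊗[K] W) where
  toFun γ := (RatFunc.X : RatFunc K) ^ (θ γ).toAdd • (σ γ).baseChange (RatFunc K)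
  map_one' := by simp [LinearMap.baseChange_one]
  map_mul' γ δ := by
    have hX : (RatFunc.X : RatFunc K) ≠ 0 := RatFunc.X_ne_zero
    simp only [map_mul, LinearMap.baseChange_mul, toAdd_mul, zpow_add₀ hX]
    rw [smul_mul_smul_comm]

/-- The extension of scalars `K ⊗_ℤ V` of an integral representation. -/
def extendScalars (K : Type*) [Field K] {V G : Type*} [AddCommGroup V] [Group G]
    (ρ : Representation ℤ G V) : Representation K G (K ⊗[ℤ] V) where
  toFun γ := (ρ γ).baseChange K
  map_one' := by simp [LinearMap.baseChange_one]
  map_mul' γ δ := by simp [LinearMap.baseChange_mul]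

/-- `τ` is a value of the twisted Reidemeister torsion `τ(N; W_θ)`: it is computed from some
fundamental family and some basis of the representation `W`. -/
def IsTwistedTorsion {N E : Type*} [TopologicalSpace N] [T2Space N] [CompactSpace N]
    [CWComplex (univ : Set N)] [TopologicalSpace E] [SimplyConnectedSpace E] {p : E → N}
    (hp : IsCoveringMap p) (e₀ : E) (θ : FundamentalGroup N (p e₀) →* Multiplicative ℤ)
    {K W : Type*} [Field K] [AddCommGroup W] [Module K W]
    (σ : Representation K (FundamentalGroup N (p e₀)) W) (τ : RatFunc K) : Prop :=
  ∃ (Φ : FundamentalFamily p) (r : ℕ) (b : Module.Basis (Fin r) K W),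
    IsTorsionOfComplex
      (κ := fun i => Σ _ : RelCWComplex.cell (univ : Set N) i, Fin r)
      (fun i => Pi.basis fun _ : RelCWComplex.cell (univ : Set N) i =>
        Algebra.TensorProduct.basis (RatFunc K) b)
      (fun i => Φ.twistedBoundary hp e₀ (twistingModule θ σ) i) τ

/-- The twisted torsion takes a value, for every finite-dimensional representation. -/
theorem exists_isTwistedTorsion {N E : Type*} [TopologicalSpace N] [T2Space N] [CompactSpace N]
    [PathConnectedSpace N] [CWComplex (univ : Set N)] [TopologicalSpace E]
    [SimplyConnectedSpace E] {p : E → N}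
    (hp : IsCoveringMap p) (e₀ : E) (θ : FundamentalGroup N (p e₀) →* Multiplicative ℤ)
    {K W : Type*} [Field K] [AddCommGroup W] [Module K W] [Module.Finite K W]
    (σ : Representation K (FundamentalGroup N (p e₀)) W) :
    ∃ τ : RatFunc K, IsTwistedTorsion hp e₀ θ σ τ := by
  obtain ⟨Φ⟩ := haveI : Nonempty E := ⟨e₀⟩; nonempty_fundamentalFamily hp
  obtain ⟨τ, hτ⟩ := exists_isTorsionOfComplex
      (κ := fun i => Σ _ : RelCWComplex.cell (univ : Set N) i, Fin (Module.finrank K W))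
      (fun i => Pi.basis fun _ : RelCWComplex.cell (univ : Set N) i =>
        Algebra.TensorProduct.basis (RatFunc K) (Module.finBasis K W))
      (fun i => Φ.twistedBoundary hp e₀ (twistingModule θ σ) i)
  exact ⟨τ, Φ, _, Module.finBasis K W, hτ⟩

/-- The width of a polynomial: the difference between the largest and the smallest exponent with
non-zero coefficient, and zero for the zero polynomial. -/
def polyWidth {K : Type*} [Field K] (f : Polynomial K) : ℤ :=
  (f.natDegree : ℤ) - (f.natTrailingDegree : ℤ)

/-- The width of a rational function, `width (f / g) = width f - width g`. -/
def width {K : Type*} [Field K] (τ : RatFunc K) : ℤ :=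
  polyWidth τ.num - polyWidth τ.denom

end

noncomputable section

/-! ### Deck transformations of a simply connected covering -/

/-! Fix one fundamental family and one integral basis of `V`. The twisted boundary operators then
become matrices `D i` over `ℤ[t, t⁻¹]`, and the twisted complexes over `ℂ(t)` and `𝔽_ℓ(t)` both
arise from these matrices by extension of scalars (`twistedCoordinates_twistedBoundary`). Any other
choice changes the torsion by a sign, a power of `t` and a non-zero constant of the field, all of
width zero. Bases of the images contribute factors that cancel in the alternating product
(`isTorsionOfComplex_unique`, `width_det_twistedCoordinates`).

For matrices with `D i * D (i + 1) = 0`, acyclicity over a field is detected by minors: it holds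
exactly when columns can be chosen such that certain square matrices, built from chosen columns and
unit vectors, are invertible. The torsion is then the alternating product of their determinants.
These determinants live in `ℤ[t, t⁻¹]`. If the complex over `ℂ(t)` is acyclic, fix such columns. For
every prime dividing no extremal coefficient of the finitely many relevant determinants, these stay
non-zero modulo the prime and keep their width, so the reduced complex is acyclic with torsion of
the same width. If the complex over `ℂ(t)` is not acyclic, neither is any reduction: minors that are
non-zero modulo a prime are non-zero over `ℤ[t, t⁻¹]`. Both torsions are then zero. The argument
does not need the geometric fact that consecutive boundaries compose to zero: a non-zero entry of
some `D i * D (i + 1)` stays non-zero modulo almost all primes, and then neither complex is acyclic.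
-/

theorem IsCoveringMap.locallyPathConnectedSpace {N E : Type*} [TopologicalSpace N]
    [TopologicalSpace E] [LocallyPathConnectedSpace N] {p : E → N} (hp : IsCoveringMap p) :
    LocallyPathConnectedSpace E := by
  choose φ hφ hφ' using hp.isLocalHomeomorph
  let _ : ChartedSpace N E :=
    { atlas := range φ
      chartAt := φ
      mem_chart_source := hφ
      chart_mem_atlas := fun x => mem_range_self x }
  exact ChartedSpace.locallyPathConnectedSpace N E

section Covering

variable {N E : Type*} [TopologicalSpace N] [TopologicalSpace E]

/-- Lift `p` through itself, once sending `x` to `y` and once sending `y` to `x`. By uniqueness of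
lifts the two maps are mutually inverse. -/
theorem exists_deck_apply_eq [SimplyConnectedSpace E] [LocallyPathConnectedSpace E] {p : E → N}
    (hp : IsCoveringMap p) {x y : E} (h : p x = p y) : ∃ g : Deck p, g.1 x = y := by
  obtain ⟨F, ⟨hF, hF'⟩, -⟩ := hp.existsUnique_continuousMap_lifts ⟨p, hp.continuous⟩ x y h.symm
  obtain ⟨G, ⟨hG, hG'⟩, -⟩ := hp.existsUnique_continuousMap_lifts ⟨p, hp.continuous⟩ y x h
  have hF1 : ∀ z, p (F z) = p z := congrFun hF'
  have hG1 : ∀ z, p (G z) = p z := congrFun hG'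
  have h1 : G ∘ F = id := hp.eq_of_comp_eq (G.continuous.comp F.continuous) continuous_id
    (funext fun z => by simp [hF1, hG1]) x (by simp [hF, hG])
  have h2 : F ∘ G = id := hp.eq_of_comp_eq (F.continuous.comp G.continuous) continuous_id
    (funext fun z => by simp [hF1, hG1]) y (by simp [hF, hG])
  exact ⟨⟨⟨⟨F, G, congrFun h1, congrFun h2⟩, F.continuous, G.continuous⟩, hF1⟩, hF⟩

omit [TopologicalSpace N] in
theorem Deck.eq_apply_iff {p : E → N} (a b g : Deck p) {x y : E} :
    a.1 x = g.1 (b.1 y) ↔ x = (a⁻¹ * g * b).1 y := by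
  constructor
  · intro H
    change x = a.1.symm (g.1 (b.1 y))
    rw [← H, Homeomorph.symm_apply_apply]
  · rintro rfl
    change a.1 (a.1.symm (g.1 (b.1 y))) = _
    rw [Homeomorph.apply_symm_apply]

section Loop

variable [SimplyConnectedSpace E] {p : E → N} (hp : IsCoveringMap p) (e₀ : E)

/-- Simple connectivity makes all paths with the same end points homotopic, so the path in the
definition may be chosen to suit. -/
theorem deckLoop_eq (g : Deck p) (γ : Path e₀ (g.1 e₀)) :
    deckLoop hp e₀ g = FundamentalGroup.fromPath (Path.Homotopic.Quotient.mk
      ((γ.map hp.continuous).cast rfl (g.2 e₀).symm)) := by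
  have h : Path.Homotopic.Quotient.mk (PathConnectedSpace.somePath e₀ (g.1 e₀)) =
      Path.Homotopic.Quotient.mk γ := Quotient.sound (SimplyConnectedSpace.paths_homotopic _ _)
  have h' := congrArg (fun q => (q.map ⟨p, hp.continuous⟩).cast rfl (g.2 e₀).symm) h
  exact h'

/-- Follow a path from `e₀` to `g e₀` by the `g`-translate of a path from `e₀` to `h e₀`. Since `p ∘
g = p`, its image is the loop of `g` followed by the loop of `h`. -/
theorem deckLoop_mul (g h : Deck p) :
    deckLoop hp e₀ (g * h) = deckLoop hp e₀ h * deckLoop hp e₀ g := by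
  rw [deckLoop_eq hp e₀ (g * h) ((PathConnectedSpace.somePath e₀ (g.1 e₀)).trans
    (((PathConnectedSpace.somePath e₀ (h.1 e₀)).map g.1.continuous).cast rfl rfl)),
    FundamentalGroup.mul_def]
  refine congrArg Path.Homotopic.Quotient.mk (a₂ := Path.trans _ _) ?_
  ext t
  change p (Path.trans _ _ t) = _
  rw [Path.trans_apply, Path.trans_apply, apply_dite p]
  split_ifs
  · rfl
  · exact g.2 _

/-- The identification of deck transformations with loops, as a homomorphism. -/
def deckHom : Deck p →* (FundamentalGroup N (p e₀))ᵐᵒᵖ :=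
  MonoidHom.mk' (fun g => MulOpposite.op (deckLoop hp e₀ g)) fun g h => by
    rw [deckLoop_mul, MulOpposite.op_mul]

theorem deckLoop_inv (g : Deck p) : deckLoop hp e₀ g⁻¹ = (deckLoop hp e₀ g)⁻¹ :=
  congrArg MulOpposite.unop (map_inv (deckHom hp e₀) g)

end Loop

variable [CWComplex (univ : Set N)]

/-- A deck transformation matching the two lifts at the centre of the ball matches them on the whole
ball, which is connected, by uniqueness of lifts. -/
theorem FundamentalFamily.exists_deck [SimplyConnectedSpace E] [LocallyPathConnectedSpace E]
    {p : E → N} (hp : IsCoveringMap p) (Φ Ψ : FundamentalFamily p) (n : ℕ)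
    (c : RelCWComplex.cell (univ : Set N) n) :
    ∃ g : Deck p, ∀ x ∈ closedBall (0 : Fin n → ℝ) 1, Ψ.lift n c x = g.1 (Φ.lift n c x) := by
  have h0 : (0 : Fin n → ℝ) ∈ closedBall (0 : Fin n → ℝ) 1 := by simp
  obtain ⟨g, hg⟩ := exists_deck_apply_eq hp
    (x := Φ.lift n c 0) (y := Ψ.lift n c 0) (by rw [Φ.lifts _ _ _ h0, Ψ.lifts _ _ _ h0])
  refine ⟨g, hp.eqOn_of_comp_eqOn (convex_closedBall _ _).isPreconnected (Ψ.continuousOn n c)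
    (g.1.continuous.comp_continuousOn (Φ.continuousOn n c)) (fun x hx => ?_) h0 hg.symm⟩
  simp only [Function.comp_apply]
  rw [Ψ.lifts _ _ _ hx, g.2, Φ.lifts _ _ _ hx]

/-! ### Change of the fundamental family -/

section Change

variable {p : E → N} {Φ Ψ : FundamentalFamily p}
  {h : ∀ n, RelCWComplex.cell (univ : Set N) n → Deck p}
  (hh : ∀ n c, ∀ x ∈ closedBall (0 : Fin n → ℝ) 1, Ψ.lift n c x = (h n c).1 (Φ.lift n c x))

include hh

theorem FundamentalFamily.collapse_eq {m : ℕ} (d : RelCWComplex.cell (univ : Set N) m)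
    (a g : Deck p) (y : E) :
    Ψ.collapse d g (a.1 y) = Φ.collapse d (a⁻¹ * g * h m d) y := by
  have key : ∀ x : Fin m → ℝ, (x ∈ ball (0 : Fin m → ℝ) 1 ∧ g.1 (Ψ.lift m d x) = a.1 y) ↔
      (x ∈ ball (0 : Fin m → ℝ) 1 ∧ (a⁻¹ * g * h m d).1 (Φ.lift m d x) = y) := by
    intro x
    refine and_congr_right fun hx => ?_
    rw [hh m d x (ball_subset_closedBall hx), eq_comm, Deck.eq_apply_iff, eq_comm]
  -- The collapse picks a preimage by choice. Equality of the predicates themselves makes the picked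
  -- points equal, without any injectivity of the lifts.
  have key' : (fun x : Fin m → ℝ => x ∈ ball (0 : Fin m → ℝ) 1 ∧ g.1 (Ψ.lift m d x) = a.1 y) =
      fun x => x ∈ ball (0 : Fin m → ℝ) 1 ∧ (a⁻¹ * g * h m d).1 (Φ.lift m d x) = y :=
    funext fun x => propext (key x)
  classical
  exact congrArg (fun P : (Fin m → ℝ) → Prop => if H : ∃ x, P x then
    (((1 - ‖H.choose‖)⁻¹ • H.choose : Fin m → ℝ) : OnePoint (Fin m → ℝ)) else OnePoint.infty) key'

theorem FundamentalFamily.incidence_eq {m : ℕ} (c : RelCWComplex.cell (univ : Set N) (m + 1))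
    (d : RelCWComplex.cell (univ : Set N) m) (g : Deck p) :
    Ψ.incidence c d g = Φ.incidence c d ((h (m + 1) c)⁻¹ * g * h m d) := by
  have h0 : (0 : Fin m → ℝ) ∈ closedBall (0 : Fin m → ℝ) 1 := by simp
  have h1 : (1 : Fin (m + 1) → ℝ) ∈ closedBall (0 : Fin (m + 1) → ℝ) 1 := by simp
  have h2 : (-1 : Fin (m + 1) → ℝ) ∈ closedBall (0 : Fin (m + 1) → ℝ) 1 := by simp
  unfold FundamentalFamily.incidence
  rw [hh _ d 0 h0, hh _ c 1 h1, hh _ c (-1) h2]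
  have hatt : Ψ.attachingMap c d g = Φ.attachingMap c d ((h (m + 1) c)⁻¹ * g * h m d) := ?_
  · rw [hatt]
    rw [propext (Deck.eq_apply_iff (h (m + 1) c) (h m d) g),
      propext (Deck.eq_apply_iff (h (m + 1) c) (h m d) g)]
  funext u
  have hu : ‖WithLp.ofLp u.1‖⁻¹ • WithLp.ofLp u.1 ∈ closedBall (0 : Fin (m + 1) → ℝ) 1 := by
    rw [mem_closedBall_zero_iff, norm_smul, norm_inv, norm_norm]
    exact inv_mul_le_one
  unfold FundamentalFamily.attachingMap
  rw [hh _ c _ hu, FundamentalFamily.collapse_eq hh]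

variable [SimplyConnectedSpace E] (hp : IsCoveringMap p) (e₀ : E)

theorem FundamentalFamily.boundaryEntry_eq {m : ℕ} (c : RelCWComplex.cell (univ : Set N) (m + 1))
    (d : RelCWComplex.cell (univ : Set N) m) :
    Ψ.boundaryEntry hp e₀ c d = Finsupp.domCongr
      ((Equiv.mulLeft (deckLoop hp e₀ (h m d))⁻¹).trans
        (Equiv.mulRight (deckLoop hp e₀ (h (m + 1) c)))) (Φ.boundaryEntry hp e₀ c d) := by
  unfold FundamentalFamily.boundaryEntry
  rw [AddEquiv.map_finsum]
  refine finsum_eq_of_bijective (fun g => (h (m + 1) c)⁻¹ * g * h m d)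
    (((Equiv.mulLeft (h (m + 1) c)⁻¹).trans (Equiv.mulRight (h m d))).bijective) fun g => ?_
  rw [FundamentalFamily.incidence_eq hh]
  simp only [Finsupp.domCongr_apply, Finsupp.equivMapDomain_single, deckLoop_mul, deckLoop_inv]
  congr 1
  rw [Equiv.trans_apply, Equiv.coe_mulLeft, Equiv.coe_mulRight]
  beta_reduce
  rw [inv_mul_cancel_left, inv_mul_cancel_right]

variable [T2Space N] [CompactSpace N]

/-- A change of the fundamental family conjugates the twisted boundary operators by the action of
the elements of the fundamental group by which the lifts of the cells differ. -/
theorem FundamentalFamily.twistedBoundary_eq {F A : Type*} [Field F] [AddCommGroup A] [Module F A]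
    (σ : Representation F (FundamentalGroup N (p e₀)) A) (i : ℕ)
    (v : RelCWComplex.cell (univ : Set N) (i + 1) → A) :
    Φ.twistedBoundary hp e₀ σ i (fun c => σ (deckLoop hp e₀ (h (i + 1) c)) (v c)) =
      fun d => σ (deckLoop hp e₀ (h i d)) (Ψ.twistedBoundary hp e₀ σ i v d) := by
  funext d
  simp only [FundamentalFamily.twistedBoundary, LinearMap.pi_apply, LinearMap.sum_apply,
    LinearMap.comp_apply, LinearMap.proj_apply, map_sum]
  refine Finset.sum_congr rfl fun c _ => ?_
  rw [FundamentalFamily.boundaryEntry_eq hh, Finsupp.domCongr_apply,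
    Finsupp.equivMapDomain_eq_mapDomain,
    Finsupp.sum_mapDomain_index_inj (Equiv.injective _), Finsupp.sum, Finsupp.sum,
    LinearMap.sum_apply, LinearMap.sum_apply, map_sum]
  refine Finset.sum_congr rfl fun γ _ => ?_
  simp only [LinearMap.smul_apply, map_zsmul]
  congr 1
  rw [← Module.End.mul_apply, ← Module.End.mul_apply, ← map_mul, ← map_mul]
  congr 2
  have (G : Type _) [Group G] (a b c : G) : b * a = c * (c⁻¹ * b * a) := by group
  exact this _ _ _ _

end Change

end Covering

/-! ### Additive functions on a field -/

section Additive

variable {F : Type*} [Field F]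

/-- A function on a field which is a homomorphism from the group of units to the integers. -/
def IsAdditiveOnUnits (w : F → ℤ) : Prop := ∀ a b, a ≠ 0 → b ≠ 0 → w (a * b) = w a + w b

variable {w : F → ℤ} (hw : IsAdditiveOnUnits w)
include hw

theorem IsAdditiveOnUnits.one : w 1 = 0 := by
  have := hw 1 1 one_ne_zero one_ne_zero
  simpa using this

/-- Since `ℤ` has no torsion, the signs caused by reorderings of bases are invisible to `w`. -/
theorem IsAdditiveOnUnits.of_sq {a : F} (ha : a * a = 1) : w a = 0 := by
  have h0 : a ≠ 0 := by rintro rfl; simp at ha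
  have := hw a a h0 h0
  rw [ha, hw.one] at this
  omega

theorem IsAdditiveOnUnits.prod {ι : Type*} (s : Finset ι) (f : ι → F) (hf : ∀ i ∈ s, f i ≠ 0) :
    w (∏ i ∈ s, f i) = ∑ i ∈ s, w (f i) := by
  classical
  induction s using Finset.induction_on with
  | empty => simpa using hw.one
  | insert a s ha ih =>
    rw [Finset.prod_insert ha, Finset.sum_insert ha, hw _ _ (hf a (by simp))
      (Finset.prod_ne_zero_iff.2 fun i hi => hf i (by simp [hi])),
      ih fun i hi => hf i (by simp [hi])]

theorem IsAdditiveOnUnits.inv {a : F} (ha : a ≠ 0) : w a⁻¹ = -w a := by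
  have := hw a a⁻¹ ha (inv_ne_zero ha)
  rw [mul_inv_cancel₀ ha, hw.one] at this
  omega

theorem IsAdditiveOnUnits.pow {a : F} (ha : a ≠ 0) (n : ℕ) : w (a ^ n) = n * w a := by
  induction n with
  | zero => simpa using hw.one
  | succ n ih => rw [pow_succ, hw _ _ (pow_ne_zero _ ha) ha, ih]; push_cast; ring

theorem IsAdditiveOnUnits.zpow {a : F} (ha : a ≠ 0) (n : ℤ) : w (a ^ n) = n * w a := by
  obtain ⟨m, rfl | rfl⟩ := n.eq_nat_or_neg
  · rw [zpow_natCast, hw.pow ha]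
  · rw [zpow_neg, zpow_natCast, hw.inv (pow_ne_zero _ ha), hw.pow ha]; ring

end Additive

/-! ### Determinants under change of basis and ordering -/

section Det

variable {F : Type*} [Field F] {M : Type*} [AddCommGroup M] [Module F M]

theorem Matrix.det_submatrix_equiv_eq {R κ ι : Type*} [CommRing R] [Fintype κ] [DecidableEq κ]
    [Fintype ι] [DecidableEq ι] (P : Matrix ι ι R) (e e' : κ ≃ ι) :
    ∃ ε : R, ε * ε = 1 ∧ (P.submatrix e e').det = ε * P.det := by
  have h : P.submatrix e e' = (P.submatrix e e).submatrix id (e'.trans e.symm) := by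
    ext; simp
  refine ⟨_, ?_, by rw [h, Matrix.det_permute', Matrix.det_submatrix_equiv_self]⟩
  rw [← Int.cast_mul, ← Units.val_mul, Int.units_mul_self, Units.val_one, Int.cast_one]

theorem Module.Basis.det_comp_equiv {κ ι : Type*} [Fintype κ] [DecidableEq κ] [Fintype ι]
    [DecidableEq ι] (c : Module.Basis κ F M) (u u' : ι → M) (P : Matrix ι ι F)
    (h : ∀ j, u' j = ∑ k, P k j • u k) (e e' : κ ≃ ι) :
    ∃ ε : F, ε * ε = 1 ∧ c.det (u' ∘ e') = ε * (c.det (u ∘ e) * P.det) := by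
  obtain ⟨ε, hε, hε'⟩ := Matrix.det_submatrix_equiv_eq P e e'
  refine ⟨ε, hε, ?_⟩
  have hm : c.toMatrix (u' ∘ e') = c.toMatrix (u ∘ e) * P.submatrix e e' := by
    ext i j
    rw [Matrix.mul_apply, Module.Basis.toMatrix_apply, Function.comp_apply, h, map_sum,
      Finsupp.finsetSum_apply, ← e.sum_comp]
    refine Finset.sum_congr rfl fun k _ => ?_
    simp [Module.Basis.toMatrix_apply, mul_comm]
  rw [Module.Basis.det_apply, Module.Basis.det_apply, hm, Matrix.det_mul, hε']
  ring

theorem IsAdditiveOnUnits.det_comp_equiv {w : F → ℤ} (hw : IsAdditiveOnUnits w)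
    {κ ι : Type*} [Fintype κ] [DecidableEq κ] [Fintype ι]
    [DecidableEq ι] (c : Module.Basis κ F M) (u u' : ι → M) (P : Matrix ι ι F)
    (h : ∀ j, u' j = ∑ k, P k j • u k) (e e' : κ ≃ ι) (hu : c.det (u ∘ e) ≠ 0) (hP : P.det ≠ 0) :
    w (c.det (u' ∘ e')) = w (c.det (u ∘ e)) + w P.det := by
  obtain ⟨ε, hε, H⟩ := c.det_comp_equiv u u' P h e e'
  have h0 : ε ≠ 0 := by rintro rfl; simp at hε
  rw [H, hw _ _ h0 (mul_ne_zero hu hP), hw.of_sq hε, hw _ _ hu hP, zero_add]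

theorem Module.Basis.det_ne_zero_of_span {κ : Type*} [Fintype κ] [DecidableEq κ]
    (c : Module.Basis κ F M) (u : κ → M) (h : ⊤ ≤ Submodule.span F (range u)) : c.det u ≠ 0 := by
  have : Module.Finite F M := Module.Finite.of_basis c
  have h1 : LinearIndependent F u := linearIndependent_of_top_le_span_of_card_eq_finrank h
    (Module.finrank_eq_card_basis c).symm
  exact ((is_basis_iff_det c).1 ⟨h1, top_le_iff.1 h⟩).ne_zero

theorem Matrix.det_eq_one_of_isEmpty {κ R : Type*} [Fintype κ] [DecidableEq κ] [CommRing R]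
    (h : IsEmpty κ) (A : Matrix κ κ R) : A.det = 1 := by
  convert! Matrix.det_isEmpty
  exact h

theorem Module.Basis.coe_eq_sum_repr {ι : Type*} [Fintype ι] {p : Submodule F M}
    (b : Module.Basis ι F p) (v : p) : (v : M) = ∑ k, b.repr v k • (b k : M) := by
  conv_lhs => rw [← b.sum_repr v]
  rw [Submodule.coe_sum]
  rfl

end Det

/-! ### Independence of the torsion of the choices -/

section Torsion

variable {F : Type*} [Field F] {M : ℕ → Type*} [∀ i, AddCommGroup (M i)] [∀ i, Module F (M i)]
  {κ : ℕ → Type*}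

section Family

variable {d : ∀ i, M (i + 1) →ₗ[F] M i} (T : TorsionChoices κ d)

/-- The basis of the image of `d (i + 1)` together with the lift of the basis of the image of
`d i`. -/
def TorsionChoices.family (i : ℕ) : Fin (T.rank (i + 1)) ⊕ Fin (T.rank i) → M (i + 1) :=
  Sum.elim (fun j => (T.imageBasis (i + 1) j : M (i + 1))) (T.lift i)

theorem TorsionChoices.rank_eq :
    T.rank = fun i => Module.finrank F (LinearMap.range (d i)) := by
  funext i
  rw [Module.finrank_eq_card_basis (T.imageBasis i), Fintype.card_fin]

theorem TorsionChoices.span_imageBasis (i : ℕ) :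
    Submodule.span F (range fun j => (T.imageBasis i j : M i)) = LinearMap.range (d i) := by
  have : (fun j => (T.imageBasis i j : M i)) =
      (LinearMap.range (d i)).subtype ∘ T.imageBasis i := rfl
  rw [this, range_comp, ← Submodule.map_span, (T.imageBasis i).span_eq, Submodule.map_top,
    Submodule.range_subtype]

/-- Subtracting from `v` the lift of `d i v` leaves a cycle, which is a boundary by exactness. -/
theorem TorsionChoices.span_family (hd : IsAcyclicComplex d) (i : ℕ) :
    ⊤ ≤ Submodule.span F (range (T.family i)) := by
  intro v _
  rw [TorsionChoices.family, Sum.elim_range, Submodule.span_union, T.span_imageBasis]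
  let a := (T.imageBasis i).repr ⟨d i v, LinearMap.mem_range_self _ _⟩
  have ha : d i (∑ j, a j • T.lift i j) = d i v := by
    simp only [map_sum, map_smul, T.d_lift]
    exact ((T.imageBasis i).coe_eq_sum_repr ⟨d i v, LinearMap.mem_range_self _ _⟩).symm
  have hk : v - ∑ j, a j • T.lift i j ∈ LinearMap.range (d (i + 1)) := by
    refine (hd.2 i _).1 ?_
    rw [map_sub, ha, sub_self]
  rw [← sub_add_cancel v (∑ j, a j • T.lift i j)]
  refine Submodule.add_mem_sup hk (Submodule.sum_mem _ fun j _ => Submodule.smul_mem _ _ ?_)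
  exact Submodule.subset_span (mem_range_self j)

end Family

variable [∀ i, Fintype (κ i)] (c : ∀ i, Module.Basis (κ i) F (M i))
  {d : ∀ i, M (i + 1) →ₗ[F] M i}

section Dets

open scoped Classical in
/-- The determinants whose alternating product is the torsion. -/
def TorsionChoices.dets (T : TorsionChoices κ d) : ℕ → F
  | 0 => (c 0).det ((fun j => (T.imageBasis 0 j : M 0)) ∘ T.indexZero)
  | i + 1 => (c (i + 1)).det (T.family i ∘ T.index i)

theorem TorsionChoices.value_eq (T : TorsionChoices κ d) {n : ℕ} (hn : ∀ i, n ≤ i → IsEmpty (κ i)) :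
    T.value c = T.dets c 0 * ∏ i ∈ Finset.range n, T.dets c (i + 1) ^ ((-1 : ℤ) ^ (i + 1)) := by
  classical
  unfold TorsionChoices.value
  congr 1
  · refine finprod_eq_prod_of_mulSupport_subset _ fun i hi => ?_
    rw [Finset.coe_range, mem_Iio]
    by_contra h
    refine hi ?_
    beta_reduce
    rw [Module.Basis.det_apply, Matrix.det_eq_one_of_isEmpty (hn _ (by omega)), one_zpow]

theorem TorsionChoices.dets_ne_zero (T : TorsionChoices κ d) (hd : IsAcyclicComplex d) (i : ℕ) :
    T.dets c i ≠ 0 := by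
  classical
  cases i with
  | zero =>
    refine (c 0).det_ne_zero_of_span _ ?_
    rw [EquivLike.range_comp, T.span_imageBasis, LinearMap.range_eq_top.2 hd.1]
  | succ i =>
    refine (c (i + 1)).det_ne_zero_of_span _ ?_
    rw [EquivLike.range_comp]
    exact T.span_family hd i

variable {w : F → ℤ} (hw : IsAdditiveOnUnits w)
include hw

theorem IsAdditiveOnUnits.torsionChoices_value (T : TorsionChoices κ d) (hd : IsAcyclicComplex d)
    {n : ℕ} (hn : ∀ i, n ≤ i → IsEmpty (κ i)) :
    w (T.value c) = w (T.dets c 0) +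
      ∑ i ∈ Finset.range n, (-1 : ℤ) ^ (i + 1) * w (T.dets c (i + 1)) := by
  have h := T.dets_ne_zero c hd
  rw [T.value_eq c hn, hw _ _ (h 0) (Finset.prod_ne_zero_iff.2 fun i _ => zpow_ne_zero _ (h _)),
    hw.prod _ _ fun i _ => zpow_ne_zero _ (h _)]
  simp_rw [hw.zpow (h _)]

/-- Here `x i` is `w` of the determinant of the base change `X i` on the image of `d i`. In degree
`i + 1` the base change is block triangular with diagonal blocks `X (i + 1)` and `X i`, because two
lifts of the same vector differ by a boundary. -/
theorem IsAdditiveOnUnits.torsionChoices_dets_eq_add (T T' : TorsionChoices κ d)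
    (hd : IsAcyclicComplex d) {n : ℕ} (hn : ∀ i, n ≤ i → IsEmpty (κ i)) :
    ∃ x : ℕ → ℤ, w (T'.dets c 0) = w (T.dets c 0) + x 0 ∧
      (∀ i, w (T'.dets c (i + 1)) = w (T.dets c (i + 1)) + (x (i + 1) + x i)) ∧ x n = 0 := by
  classical
  have hr := T.rank_eq.trans T'.rank_eq.symm
  have h0 := T.dets_ne_zero c hd
  obtain ⟨r, β, l, hl, e0, e⟩ := T
  obtain ⟨r', β', l', hl', e0', e'⟩ := T'
  -- Both rank functions are the dimensions of the images.
  obtain rfl : r = r' := hr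
  let X : ∀ i, Matrix (Fin (r i)) (Fin (r i)) F := fun i => (β i).toMatrix (β' i)
  have hX : ∀ i, (X i).det ≠ 0 := fun i => by
    have := ((β i).isUnit_det (β' i)).ne_zero
    rwa [Module.Basis.det_apply] at this
  have hβ : ∀ i j, (β' i j : M i) = ∑ k, X i k j • (β i k : M i) := by
    intro i j
    exact (β i).coe_eq_sum_repr (β' i j)
  have hk : ∀ i j, l' i j - ∑ k, X i k j • l i k ∈ LinearMap.range (d (i + 1)) := by
    intro i j
    refine (hd.2 i _).1 ?_
    rw [map_sub, map_sum]
    simp only [map_smul, hl, hl', hβ, sub_self]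
  let Y : ∀ i, Matrix (Fin (r (i + 1))) (Fin (r i)) F := fun i =>
    Matrix.of fun k j => (β (i + 1)).repr ⟨_, hk i j⟩ k
  have hY : ∀ i j, l' i j = ∑ k, Y i k j • (β (i + 1) k : M (i + 1)) + ∑ k, X i k j • l i k := by
    intro i j
    rw [← sub_eq_iff_eq_add]
    exact (β (i + 1)).coe_eq_sum_repr ⟨_, hk i j⟩
  refine ⟨fun i => w (X i).det, ?_, fun i => ?_, ?_⟩
  · exact hw.det_comp_equiv (c 0) _ _ (X 0) (hβ 0) e0 e0' (h0 0) (hX 0)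
  · have hdet : (Matrix.fromBlocks (X (i + 1)) (Y i) 0 (X i)).det = (X (i + 1)).det * (X i).det :=
      Matrix.det_fromBlocks_zero₂₁ _ _ _
    rw [← hw _ _ (hX _) (hX _), ← hdet]
    refine hw.det_comp_equiv (c (i + 1)) _ _ _ ?_ (e i) (e' i) (h0 (i + 1))
      (hdet ▸ mul_ne_zero (hX _) (hX _))
    rintro (j | j)
    · simpa [TorsionChoices.family] using hβ (i + 1) j
    · simpa [TorsionChoices.family] using hY i j
  · have := hn (n + 1) (by omega)
    have : IsEmpty (Fin (r n)) := ⟨fun j => this.elim ((e n).symm (Sum.inr j))⟩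
    simpa [Matrix.det_isEmpty] using hw.one

theorem IsAdditiveOnUnits.torsionChoices_value_eq (T T' : TorsionChoices κ d)
    (hd : IsAcyclicComplex d) {n : ℕ} (hn : ∀ i, n ≤ i → IsEmpty (κ i)) :
    w (T'.value c) = w (T.value c) := by
  obtain ⟨x, hx0, hx, hxn⟩ := hw.torsionChoices_dets_eq_add c T T' hd hn
  rw [hw.torsionChoices_value c T hd hn, hw.torsionChoices_value c T' hd hn, hx0]
  simp_rw [hx]
  -- The corrections telescope; the last term vanishes because `x n = 0`.
  have key : ∀ m, x 0 + ∑ i ∈ Finset.range m, (-1 : ℤ) ^ (i + 1) * (x (i + 1) + x i) =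
      (-1) ^ m * x m := by
    intro m
    induction m with
    | zero => simp
    | succ m ih => rw [Finset.sum_range_succ, ← add_assoc, ih]; ring
  have := key n
  rw [hxn] at this
  simp_rw [mul_add (_ ^ _) (w _), Finset.sum_add_distrib]
  linarith

open scoped Classical in
theorem IsAdditiveOnUnits.torsionChoices_value_basis (c' : ∀ i, Module.Basis (κ i) F (M i))
    (hc : ∀ i, w ((c i).det (c' i)) = 0) (T : TorsionChoices κ d)
    (hd : IsAcyclicComplex d) {n : ℕ} (hn : ∀ i, n ≤ i → IsEmpty (κ i)) :
    w (T.value c') = w (T.value c) := by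
  have key : ∀ i (v : κ i → M i), (c' i).det v ≠ 0 → w ((c i).det v) = w ((c' i).det v) := by
    intro i v hv
    have := congrArg (fun f => f v) ((c i).det.eq_smul_basis_det (c' i))
    simp only [AlternatingMap.smul_apply, smul_eq_mul] at this
    rw [this, hw _ _ ((c i).isUnit_det (c' i)).ne_zero hv, hc, zero_add]
  have key' : ∀ i, w (T.dets c i) = w (T.dets c' i) := by
    rintro (_ | i)
    · exact key _ _ (T.dets_ne_zero c' hd 0)
    · exact key _ _ (T.dets_ne_zero c' hd (i + 1))
  rw [hw.torsionChoices_value c T hd hn, hw.torsionChoices_value c' T hd hn]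
  simp_rw [key']

open scoped Classical in
/-- The torsion is well defined up to elements on which `w` vanishes. -/
theorem IsAdditiveOnUnits.isTorsionOfComplex_unique {c c' : ∀ i, Module.Basis (κ i) F (M i)}
    (hc : ∀ i, w ((c i).det (c' i)) = 0) {n : ℕ} (hn : ∀ i, n ≤ i → IsEmpty (κ i)) {τ τ' : F}
    (h : IsTorsionOfComplex c d τ) (h' : IsTorsionOfComplex c' d τ') : w τ = w τ' := by
  rcases h with ⟨hd, T, rfl⟩ | ⟨hd, rfl⟩
  · rcases h' with ⟨-, T', rfl⟩ | ⟨hd', -⟩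
    · rw [hw.torsionChoices_value_basis c c' hc T' hd hn, hw.torsionChoices_value_eq c T T' hd hn]
    · exact absurd hd hd'
  · rcases h' with ⟨hd', -⟩ | ⟨-, rfl⟩
    · exact absurd hd' hd
    · rfl

end Dets

/-! ### Isomorphic complexes have the same torsion -/

section Transport

variable {M' : ℕ → Type*} [∀ i, AddCommGroup (M' i)] [∀ i, Module F (M' i)]
  {d' : ∀ i, M' (i + 1) →ₗ[F] M' i} (e : ∀ i, M i ≃ₗ[F] M' i)
  (he : ∀ i v, e i (d i v) = d' i (e (i + 1) v))
include he

theorem LinearEquiv.isAcyclicComplex_iff : IsAcyclicComplex d ↔ IsAcyclicComplex d' := by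
  unfold IsAcyclicComplex
  refine and_congr ?_ (forall_congr' fun i => ?_)
  · have : d' 0 ∘ e 1 = e 0 ∘ d 0 := funext fun v => (he 0 v).symm
    rw [← (e 1).surjective.of_comp_iff (d' 0), this]
    exact ((e 0).toEquiv.comp_surjective _).symm
  · exact (Function.Exact.iff_of_ladder_linearEquiv (e₁ := e (i + 2)) (e₂ := e (i + 1)) (e₃ := e i)
      (LinearMap.ext fun v => (he (i + 1) v).symm) (LinearMap.ext fun v => (he i v).symm)).symm

theorem LinearEquiv.map_range_eq (i : ℕ) :
    (LinearMap.range (d i)).map (e i : M i →ₗ[F] M' i) = LinearMap.range (d' i) := by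
  ext v
  constructor
  · rintro ⟨_, ⟨u, rfl⟩, rfl⟩
    exact ⟨e (i + 1) u, (he i u).symm⟩
  · rintro ⟨u, rfl⟩
    refine ⟨_, ⟨(e (i + 1)).symm u, rfl⟩, ?_⟩
    simpa using he i ((e (i + 1)).symm u)

/-- Transport of choices along an isomorphism of complexes. -/
def TorsionChoices.map (T : TorsionChoices κ d) : TorsionChoices κ d' where
  rank := T.rank
  imageBasis i := (T.imageBasis i).map (((e i).submoduleMap _).trans
    (LinearEquiv.ofEq _ _ (LinearEquiv.map_range_eq e he i)))
  lift i j := e (i + 1) (T.lift i j)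
  d_lift i j := by rw [← he, T.d_lift]; rfl
  indexZero := T.indexZero
  index := T.index

theorem TorsionChoices.value_map (T : TorsionChoices κ d) :
    (T.map e he).value (fun i => (c i).map (e i)) = T.value c := by
  classical
  unfold TorsionChoices.value
  have h1 : ∀ i j, (((T.map e he).imageBasis i j : LinearMap.range (d' i)) : M' i) =
      e i (T.imageBasis i j : M i) := fun i j => rfl
  congr 1
  · rw [Module.Basis.det_map]
    congr 1
    funext k
    simp only [Function.comp_apply, h1, LinearEquiv.symm_apply_apply]
    rfl
  · refine finprod_congr fun i => ?_
    rw [Module.Basis.det_map]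
    congr 2
    funext k
    simp only [Function.comp_apply]
    change (e (i + 1)).symm (Sum.elim _ _ (T.index i k)) = _
    rcases T.index i k with j | j
    · exact (e (i + 1)).symm_apply_apply _
    · exact (e (i + 1)).symm_apply_apply _

variable {c} in
theorem IsTorsionOfComplex.map {τ : F} (h : IsTorsionOfComplex c d τ) :
    IsTorsionOfComplex (fun i => (c i).map (e i)) d' τ := by
  rcases h with ⟨hd, T, rfl⟩ | ⟨hd, rfl⟩
  · exact .inl ⟨(LinearEquiv.isAcyclicComplex_iff e he).1 hd, T.map e he,
      (T.value_map c e he).symm⟩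
  · exact .inr ⟨fun h => hd ((LinearEquiv.isAcyclicComplex_iff e he).2 h), rfl⟩

end Transport

end Torsion

/-! ### Torsion of complexes given by matrices over a ring -/

/-- A choice of columns of the boundary matrices of a based complex, with orderings so that the
columns chosen in degree `i` and the basis vectors chosen in degree `i - 1` form a square matrix. -/
structure ColumnChoice (κ : ℕ → Type*) where
  rank : ℕ → ℕ
  col (i : ℕ) : Fin (rank i) → κ (i + 1)
  indexZero : κ 0 ≃ Fin (rank 0)
  index (i : ℕ) : κ (i + 1) ≃ Fin (rank (i + 1)) ⊕ Fin (rank i)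

section Minor

variable {κ : ℕ → Type*} [∀ i, DecidableEq (κ i)] (S : ColumnChoice κ) {R : Type*} [CommRing R]

/-- The square matrices formed by the chosen columns of the boundary operator and the basis vectors
that belong to the columns chosen one degree below. -/
def ColumnChoice.minor (D : ∀ i, Matrix (κ i) (κ (i + 1)) R) : ∀ i, Matrix (κ i) (κ i) R
  | 0 => (D 0).submatrix id (S.col 0 ∘ S.indexZero)
  | i + 1 => (Matrix.fromCols ((D (i + 1)).submatrix id (S.col (i + 1)))
      ((1 : Matrix (κ (i + 1)) (κ (i + 1)) R).submatrix id (S.col i))).submatrix id (S.index i)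

/-- This compatibility lets one determinant over the ring control both fields. -/
theorem ColumnChoice.minor_map (D : ∀ i, Matrix (κ i) (κ (i + 1)) R) {R' : Type*} [CommRing R']
    (φ : R →+* R') (i : ℕ) : S.minor (fun i => (D i).map φ) i = (S.minor D i).map φ := by
  cases i with
  | zero => rfl
  | succ i =>
    ext k l
    simp only [ColumnChoice.minor, Matrix.map_apply, Matrix.submatrix_apply]
    rcases S.index i l with j | j
    · simp
    · simp [Matrix.one_apply, apply_ite φ]

theorem ColumnChoice.det_minor_map [∀ i, Fintype (κ i)] (D : ∀ i, Matrix (κ i) (κ (i + 1)) R)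
    {R' : Type*} [CommRing R'] (φ : R →+* R') (i : ℕ) :
    (S.minor (fun i => (D i).map φ) i).det = φ (S.minor D i).det := by
  rw [S.minor_map, RingHom.map_det]
  rfl

end Minor

/-! ### Acyclicity and torsion in terms of minors -/

section Field

open scoped Classical

variable {κ : ℕ → Type*} [∀ i, Fintype (κ i)] {F : Type*} [Field F]
  {D : ∀ i, Matrix (κ i) (κ (i + 1)) F}

/-- The choices for the torsion given by a choice of columns that are bases of the images. -/
def ColumnChoice.torsionChoices (S : ColumnChoice κ)
    (β : ∀ i, Module.Basis (Fin (S.rank i)) F (LinearMap.range (D i).mulVecLin))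
    (hβ : ∀ i j, (β i j : κ i → F) = (D i).col (S.col i j)) :
    TorsionChoices (M := fun i => κ i → F) κ (fun i => (D i).mulVecLin) where
  rank := S.rank
  imageBasis := β
  lift i j := Pi.single (S.col i j) 1
  d_lift i j := by rw [hβ, Matrix.mulVecLin_apply, Matrix.mulVec_single_one]
  indexZero := S.indexZero
  index := S.index

/-- Unit vectors lift the chosen columns, so the matrices comparing the bases are exactly the
minors. -/
theorem ColumnChoice.dets_torsionChoices (S : ColumnChoice κ)
    (β : ∀ i, Module.Basis (Fin (S.rank i)) F (LinearMap.range (D i).mulVecLin))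
    (hβ : ∀ i j, (β i j : κ i → F) = (D i).col (S.col i j)) (i : ℕ) :
    (S.torsionChoices β hβ).dets (fun i => Pi.basisFun F (κ i)) i = (S.minor D i).det := by
  cases i with
  | zero =>
    rw [TorsionChoices.dets, Module.Basis.det_apply]
    congr! 1
    ext k l
    rw [Module.Basis.toMatrix_apply, Pi.basisFun_repr]
    exact congrFun (hβ 0 _) k
  | succ i =>
    rw [TorsionChoices.dets, Module.Basis.det_apply]
    congr! 1
    ext k l
    rw [Module.Basis.toMatrix_apply, Pi.basisFun_repr]
    change TorsionChoices.family (S.torsionChoices β hβ) i (S.index i l) k =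
      Matrix.fromCols _ _ k (S.index i l)
    rcases S.index i l with j | j
    · exact congrFun (hβ (i + 1) _) k
    · simp [TorsionChoices.family, ColumnChoice.torsionChoices, Pi.single_apply, Matrix.one_apply]

/-- The columns span the image, so some of them form a basis of it. Exactness and rank-nullity
provide the index bijections. -/
theorem ColumnChoice.exists_of_isAcyclicComplex
    (h : IsAcyclicComplex (M := fun i => κ i → F) fun i => (D i).mulVecLin) :
    ∃ S : ColumnChoice κ, ∀ i, (S.minor D i).det ≠ 0 := by
  have hs : ∀ i, LinearMap.range (D i).mulVecLin = Submodule.span F (range (D i).col) :=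
    fun i => Matrix.range_mulVecLin _
  choose f hf hf' hli using fun i => Submodule.exists_fun_fin_finrank_span_eq F (range (D i).col)
  choose l hl using hf
  have h0 : Fintype.card (κ 0) = Module.finrank F (Submodule.span F (range (D 0).col)) := by
    rw [← hs, LinearMap.range_eq_top.2 h.1, finrank_top, Module.finrank_fintype_fun_eq_card]
  have h1 : ∀ i, Fintype.card (κ (i + 1)) =
      Module.finrank F (Submodule.span F (range (D (i + 1)).col)) +
      Module.finrank F (Submodule.span F (range (D i).col)) := by
    intro i
    have hk : LinearMap.ker (D i).mulVecLin = LinearMap.range (D (i + 1)).mulVecLin :=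
      LinearMap.exact_iff.1 (h.2 i)
    rw [← hs, ← hs, ← hk, add_comm (Module.finrank F _), LinearMap.finrank_range_add_finrank_ker,
      Module.finrank_fintype_fun_eq_card]
  let S : ColumnChoice κ := ⟨_, l, Fintype.equivFinOfCardEq h0,
    fun i => (Fintype.equivFinOfCardEq (h1 i)).trans finSumFinEquiv.symm⟩
  let β : ∀ i, Module.Basis (Fin (S.rank i)) F (LinearMap.range (D i).mulVecLin) := fun i =>
    (Module.Basis.span (hli i)).map (LinearEquiv.ofEq _ _ ((hf' i).trans (hs i).symm))
  have hβ : ∀ i j, (β i j : κ i → F) = (D i).col (S.col i j) := by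
    intro i j
    rw [hl, Module.Basis.map_apply, LinearEquiv.coe_ofEq_apply, Module.Basis.span_apply]
  exact ⟨S, fun i => S.dets_torsionChoices β hβ i ▸
    TorsionChoices.dets_ne_zero (M := fun i => κ i → F) _ _ h i⟩

variable {S : ColumnChoice κ} (hS : ∀ i, (S.minor D i).det ≠ 0)
include hS

theorem ColumnChoice.basis_of_det_minor_ne_zero (i : ℕ) :
    LinearIndependent F (S.minor D i).col ∧ Submodule.span F (range (S.minor D i).col) = ⊤ := by
  rw [Module.Basis.is_basis_iff_det (Pi.basisFun F (κ i)), Module.Basis.det_apply,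
    isUnit_iff_ne_zero]
  exact hS i

theorem ColumnChoice.linearIndependent_col (i : ℕ) :
    LinearIndependent F fun j => (D i).col (S.col i j) := by
  have h := (S.basis_of_det_minor_ne_zero hS i).1
  cases i with
  | zero =>
    convert h.comp _ S.indexZero.symm.injective using 1
    funext j k
    simp [ColumnChoice.minor]
  | succ i =>
    convert h.comp _ ((S.index i).symm.injective.comp Sum.inl_injective) using 1
    funext j k
    simp [ColumnChoice.minor]

theorem ColumnChoice.exists_eq_add (i : ℕ) (v : κ (i + 1) → F) :
    ∃ (a : Fin (S.rank (i + 1)) → F) (b : Fin (S.rank i) → F),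
      v = ∑ j, a j • (D (i + 1)).col (S.col (i + 1) j) +
      ∑ j, b j • Pi.single (S.col i j) (1 : F) := by
  have h : v ∈ Submodule.span F (range (S.minor D (i + 1)).col) := by
    rw [(S.basis_of_det_minor_ne_zero hS (i + 1)).2]; trivial
  obtain ⟨a, rfl⟩ := (Submodule.mem_span_range_iff_exists_fun F).1 h
  refine ⟨fun j => a ((S.index i).symm (Sum.inl j)), fun j => a ((S.index i).symm (Sum.inr j)), ?_⟩
  rw [← (S.index i).symm.sum_comp, Fintype.sum_sum_type]
  congr 1
  · refine Finset.sum_congr rfl fun j _ => ?_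
    congr 1
    funext k
    simp [ColumnChoice.minor]
  · refine Finset.sum_congr rfl fun j _ => ?_
    congr 1
    funext k
    simp [ColumnChoice.minor, Matrix.one_apply, Pi.single_apply]

variable (hD : ∀ i, D i * D (i + 1) = 0)
include hD

omit hS in
theorem ColumnChoice.mulVec_eq_sum (i : ℕ) (a : Fin (S.rank (i + 1)) → F)
    (b : Fin (S.rank i) → F) :
    (D i).mulVec (∑ j, a j • (D (i + 1)).col (S.col (i + 1) j) +
      ∑ j, b j • Pi.single (S.col i j) (1 : F)) = ∑ j, b j • (D i).col (S.col i j) := by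
  rw [← Matrix.mulVecLin_apply, map_add, map_sum, map_sum]
  simp only [map_smul, Matrix.mulVecLin_apply, Matrix.mulVec_single_one]
  rw [Finset.sum_eq_zero, zero_add]
  intro j _
  rw [← Matrix.mulVec_single_one, Matrix.mulVec_mulVec, hD, Matrix.zero_mulVec, smul_zero]

theorem ColumnChoice.range_mulVecLin (i : ℕ) :
    Submodule.span F (range fun j => (D i).col (S.col i j)) = LinearMap.range (D i).mulVecLin := by
  refine le_antisymm ?_ ?_
  · rw [Submodule.span_le]
    rintro _ ⟨j, rfl⟩
    exact ⟨Pi.single (S.col i j) 1, by simp⟩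
  · rintro _ ⟨v, rfl⟩
    obtain ⟨a, b, rfl⟩ := S.exists_eq_add hS i v
    rw [Matrix.mulVecLin_apply, S.mulVec_eq_sum hD]
    exact Submodule.sum_mem _ fun j _ => Submodule.smul_mem _ _
      (Submodule.subset_span (mem_range_self j))

/-- Write a cycle as a combination of chosen columns and unit vectors. Applying `D i` kills the
first part and sends the second to a combination of independent columns, so only boundaries remain.
-/
theorem ColumnChoice.isAcyclicComplex :
    IsAcyclicComplex (M := fun i => κ i → F) fun i => (D i).mulVecLin := by
  refine ⟨?_, fun i v => ⟨fun hv => ?_, ?_⟩⟩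
  · rw [← LinearMap.range_eq_top, ← S.range_mulVecLin hS hD, eq_top_iff,
      ← (S.basis_of_det_minor_ne_zero hS 0).2]
    refine Submodule.span_mono ?_
    rintro _ ⟨k, rfl⟩
    exact ⟨S.indexZero k, rfl⟩
  · obtain ⟨a, b, rfl⟩ := S.exists_eq_add hS i v
    rw [Matrix.mulVecLin_apply, S.mulVec_eq_sum hD] at hv
    have hb := Fintype.linearIndependent_iff.1 (S.linearIndependent_col hS i) b hv
    refine ⟨∑ j, a j • Pi.single (S.col (i + 1) j) 1, ?_⟩
    simp [hb, map_sum]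
  · rintro ⟨u, rfl⟩
    rw [Matrix.mulVecLin_apply, Matrix.mulVecLin_apply, Matrix.mulVec_mulVec, hD,
      Matrix.zero_mulVec]

theorem ColumnChoice.exists_torsionChoices :
    ∃ T : TorsionChoices (M := fun i => κ i → F) κ (fun i => (D i).mulVecLin),
      ∀ i, T.dets (fun i => Pi.basisFun F (κ i)) i = (S.minor D i).det := by
  refine ⟨S.torsionChoices (fun i => (Module.Basis.span (S.linearIndependent_col hS i)).map
    (LinearEquiv.ofEq _ _ (S.range_mulVecLin hS hD i))) fun i j => ?_, S.dets_torsionChoices _ _⟩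
  rw [Module.Basis.map_apply, LinearEquiv.coe_ofEq_apply, Module.Basis.span_apply]

end Field

/-! ### Comparison of two fields under one ring -/

section Compare

variable {κ : ℕ → Type*} [∀ i, Fintype (κ i)] {R : Type*} [CommRing R]
  (D : ∀ i, Matrix (κ i) (κ (i + 1)) R)

theorem mul_eq_zero_of_isAcyclicComplex {F : Type*} [Field F]
    {D : ∀ i, Matrix (κ i) (κ (i + 1)) F}
    (h : IsAcyclicComplex (M := fun i => κ i → F) fun i => (D i).mulVecLin) (i : ℕ) :
    D i * D (i + 1) = 0 := by
  classical
  refine Matrix.toLin'.injective ?_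
  rw [Matrix.toLin'_mul, map_zero]
  exact (h.2 i).linearMap_comp_eq_zero

variable {D} in
theorem not_isAcyclicComplex_of_map_ne_zero {F : Type*} [Field F] (ψ : R →+* F) {i : ℕ}
    {k : κ i} {l : κ (i + 2)} (h : ψ ((D i * D (i + 1)) k l) ≠ 0) :
    ¬ IsAcyclicComplex (M := fun i => κ i → F) fun i => ((D i).map ψ).mulVecLin := by
  intro hac
  have := congrFun (congrFun (mul_eq_zero_of_isAcyclicComplex hac i) k) l
  rw [← Matrix.map_mul] at this
  exact h this

/-- The values of the torsion of a complex of matrices over a ring, after extension of scalars to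
a field containing the ring and after reduction to another field, agree for an additive invariant
if the reduction preserves this invariant for finitely many elements of the ring. -/
theorem exists_finset_forall_isTorsionOfComplex_eq {n : ℕ} (hn : ∀ i, n ≤ i → IsEmpty (κ i))
    {F : Type*} [Field F] {φ : R →+* F} (hφ : Function.Injective φ) {w : F → ℤ}
    (hw : IsAdditiveOnUnits w) (hw0 : w 0 = 0) :
    ∃ B : Finset R, (∀ b ∈ B, b ≠ 0) ∧
      ∀ {F' : Type} [Field F'] (ψ : R →+* F') {w' : F' → ℤ} (_ : IsAdditiveOnUnits w')
        (_ : w' 0 = 0) (_ : ∀ b ∈ B, ψ b ≠ 0 ∧ w' (ψ b) = w (φ b)) {τ : F} {τ' : F'}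
        (_ : IsTorsionOfComplex (fun i => Pi.basisFun F (κ i))
          (fun i => ((D i).map φ).mulVecLin) τ)
        (_ : IsTorsionOfComplex (fun i => Pi.basisFun F' (κ i))
          (fun i => ((D i).map ψ).mulVecLin) τ'), w' τ' = w τ := by
  classical
  by_cases hD : ∀ i, D i * D (i + 1) = 0
  swap
  · push Not at hD
    obtain ⟨i, hi⟩ := hD
    obtain ⟨k, l, hkl⟩ : ∃ k l, (D i * D (i + 1)) k l ≠ 0 := by
      by_contra! H
      exact hi (Matrix.ext H)
    refine ⟨{(D i * D (i + 1)) k l}, by simpa using hkl, ?_⟩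
    intro F' _ ψ w' hw' hw0' hB τ τ' hτ hτ'
    have h1 := not_isAcyclicComplex_of_map_ne_zero (D := D) (k := k) (l := l) φ
      ((map_ne_zero_iff φ hφ).2 hkl)
    have h2 := not_isAcyclicComplex_of_map_ne_zero (D := D) (k := k) (l := l) ψ (hB _ (by simp)).1
    obtain rfl : τ = 0 := (hτ.resolve_left fun h => h1 h.1).2
    obtain rfl : τ' = 0 := (hτ'.resolve_left fun h => h2 h.1).2
    rw [hw0, hw0']
  have hDF : ∀ i, (D i).map φ * (D (i + 1)).map φ = 0 := fun i => by
    rw [← Matrix.map_mul, hD, Matrix.map_zero _ (map_zero φ)]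
  by_cases hac : IsAcyclicComplex (M := fun i => κ i → F) fun i => ((D i).map φ).mulVecLin
  · obtain ⟨S, hS⟩ := ColumnChoice.exists_of_isAcyclicComplex hac
    -- The product formula for the torsion involves the degrees `0` to `n`; beyond them the minors
    -- are empty with determinant `1`.
    refine ⟨(Finset.range (n + 1)).image fun i => (S.minor D i).det, ?_, ?_⟩
    · simp only [Finset.mem_image, forall_exists_index, and_imp, forall_apply_eq_imp_iff₂]
      intro i _ h0
      refine hS i ?_
      rw [S.det_minor_map, h0, map_zero]
    intro F' _ ψ w' hw' hw0' hB τ τ' hτ hτ'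
    simp only [Finset.mem_image, forall_exists_index, and_imp, forall_apply_eq_imp_iff₂,
      Finset.mem_range] at hB
    have hDF' : ∀ i, (D i).map ψ * (D (i + 1)).map ψ = 0 := fun i => by
      rw [← Matrix.map_mul, hD, Matrix.map_zero _ (map_zero ψ)]
    have hS' : ∀ i, (S.minor (fun i => (D i).map ψ) i).det ≠ 0 := by
      intro i
      by_cases hi : i < n + 1
      · rw [S.det_minor_map]
        exact (hB i hi).1
      · rw [Matrix.det_eq_one_of_isEmpty (hn i (by omega))]
        exact one_ne_zero
    have hac' := ColumnChoice.isAcyclicComplex hS' hDF'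
    obtain ⟨T, hT⟩ := ColumnChoice.exists_torsionChoices hS hDF
    obtain ⟨T', hT'⟩ := ColumnChoice.exists_torsionChoices hS' hDF'
    have h1 := hw.isTorsionOfComplex_unique (fun i => by
      rw [Module.Basis.det_self, hw.one]) hn hτ (.inl ⟨hac, T, rfl⟩)
    have h2 := hw'.isTorsionOfComplex_unique (fun i => by
      rw [Module.Basis.det_self, hw'.one]) hn hτ' (.inl ⟨hac', T', rfl⟩)
    rw [h1, h2, hw.torsionChoices_value _ T hac hn, hw'.torsionChoices_value _ T' hac' hn]
    have h3 : ∀ i < n + 1, w' (T'.dets (fun i => Pi.basisFun F' (κ i)) i) =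
        w (T.dets (fun i => Pi.basisFun F (κ i)) i) := by
      intro i hi
      rw [hT, hT', S.det_minor_map, S.det_minor_map]
      exact (hB i hi).2
    rw [h3 0 (by omega)]
    congr 1
    refine Finset.sum_congr rfl fun i hi => ?_
    rw [h3 (i + 1) (by simpa using hi)]
  -- No condition is needed: non-zero minors over `F'` come from non-zero minors over the ring,
  -- which would make the complex over `F` acyclic.
  · refine ⟨∅, by simp, ?_⟩
    intro F' _ ψ w' hw' hw0' _ τ τ' hτ hτ'
    obtain rfl : τ = 0 := (hτ.resolve_left fun h => hac h.1).2
    rcases hτ' with ⟨hac', -⟩ | ⟨-, rfl⟩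
    · obtain ⟨S, hS⟩ := ColumnChoice.exists_of_isAcyclicComplex hac'
      refine absurd (ColumnChoice.isAcyclicComplex (S := S) (fun i => ?_) hDF) hac
      have := hS i
      rw [S.det_minor_map] at this ⊢
      rw [map_ne_zero_iff φ hφ]
      exact fun h => this (by rw [h, map_zero])
    · rw [hw0, hw0']

end Compare

/-! ### The width -/

section Width

variable {K : Type*} [Field K]

theorem polyWidth_mul {f g : Polynomial K} (hf : f ≠ 0) (hg : g ≠ 0) :
    polyWidth (f * g) = polyWidth f + polyWidth g := by
  unfold polyWidth
  rw [Polynomial.natDegree_mul hf hg, Polynomial.natTrailingDegree_mul hf hg]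
  push_cast
  ring

theorem width_algebraMap (f : Polynomial K) :
    width (algebraMap (Polynomial K) (RatFunc K) f) = polyWidth f := by
  rw [width, RatFunc.num_algebraMap, RatFunc.denom_algebraMap]
  simp [polyWidth]

theorem width_zero : width (0 : RatFunc K) = 0 := by
  simp [width, polyWidth]

/-- The width is read off the reduced fraction; the cross-multiplied identity between reduced
fractions absorbs any cancellation. -/
theorem isAdditiveOnUnits_width : IsAdditiveOnUnits (width : RatFunc K → ℤ) := by
  intro x y hx hy
  have h := congrArg polyWidth (RatFunc.num_denom_mul x y)
  have h1 := RatFunc.num_ne_zero hx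
  have h2 := RatFunc.num_ne_zero hy
  have h3 := RatFunc.num_ne_zero (mul_ne_zero hx hy)
  have h4 := RatFunc.denom_ne_zero x
  have h5 := RatFunc.denom_ne_zero y
  have h6 := RatFunc.denom_ne_zero (x * y)
  rw [polyWidth_mul h3 (mul_ne_zero h4 h5), polyWidth_mul h4 h5,
    polyWidth_mul (mul_ne_zero h1 h2) h6, polyWidth_mul h1 h2] at h
  unfold width
  linarith

theorem width_X : width (RatFunc.X : RatFunc K) = 0 := by
  rw [← RatFunc.algebraMap_X, width_algebraMap]
  simp [polyWidth]

theorem width_algebraMap_field (a : K) : width (algebraMap K (RatFunc K) a) = 0 := by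
  rw [IsScalarTower.algebraMap_apply K (Polynomial K) (RatFunc K), width_algebraMap]
  simp [polyWidth]

theorem width_X_zpow (n : ℤ) : width ((RatFunc.X : RatFunc K) ^ n) = 0 := by
  rw [isAdditiveOnUnits_width.zpow RatFunc.X_ne_zero, width_X, mul_zero]

/-- The determinant is a power of `t` times a non-zero constant of `K`. -/
theorem width_det_smul_baseChange {W : Type*} [AddCommGroup W] [Module K W] [Module.Finite K W]
    (g : W ≃ₗ[K] W) (n : ℤ) :
    LinearMap.det ((RatFunc.X : RatFunc K) ^ n • (g : W →ₗ[K] W).baseChange (RatFunc K)) ≠ 0 ∧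
      width (LinearMap.det
        ((RatFunc.X : RatFunc K) ^ n • (g : W →ₗ[K] W).baseChange (RatFunc K))) = 0 := by
  have h1 : ((RatFunc.X : RatFunc K) ^ n) ^ (Module.finrank (RatFunc K) (RatFunc K ⊗[K] W)) ≠ 0 :=
    pow_ne_zero _ (zpow_ne_zero _ RatFunc.X_ne_zero)
  have h2 : algebraMap K (RatFunc K) (LinearMap.det (g : W →ₗ[K] W)) ≠ 0 :=
    (map_ne_zero _).2 (LinearEquiv.isUnit_det' g).ne_zero
  rw [LinearMap.det_smul, LinearMap.det_baseChange]
  refine ⟨mul_ne_zero h1 h2, ?_⟩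
  rw [isAdditiveOnUnits_width _ _ h1 h2, isAdditiveOnUnits_width.pow
    (zpow_ne_zero _ RatFunc.X_ne_zero), width_X_zpow, width_algebraMap_field, mul_zero, add_zero]

end Width

/-! ### Reduction of integral Laurent polynomials -/

section Laurent

open LaurentPolynomial

variable (K : Type*) [Field K]

/-- The extension of scalars from `ℤ[t, t⁻¹]` to `K(t)`. -/
def laurentHom : ℤ[T;T⁻¹] →+* RatFunc K :=
  eval₂ (Int.castRingHom (RatFunc K)) (Units.mk0 RatFunc.X RatFunc.X_ne_zero)

theorem laurentHom_T (n : ℤ) : laurentHom K (T n) = RatFunc.X ^ n := by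
  rw [laurentHom, eval₂_T, Units.val_zpow_eq_zpow_val, Units.val_mk0]

theorem laurentHom_C (n : ℤ) : laurentHom K (C n) = n := by
  rw [laurentHom, eval₂_C]
  rfl

theorem laurentHom_toLaurent (g : Polynomial ℤ) : laurentHom K (Polynomial.toLaurent g) =
    algebraMap (Polynomial K) (RatFunc K) (g.map (Int.castRingHom K)) := by
  induction g using Polynomial.induction_on' with
  | add p q hp hq => simp only [map_add, Polynomial.map_add, hp, hq]
  | monomial n a =>
    rw [← Polynomial.C_mul_X_pow_eq_monomial, map_mul, map_mul, Polynomial.toLaurent_C,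
      Polynomial.toLaurent_X_pow, laurentHom_C, laurentHom_T]
    simp

/-- The point is uniformity: the same `n` and `g` serve all fields. -/
theorem exists_laurentHom_eq (f : ℤ[T;T⁻¹]) : ∃ (n : ℤ) (g : Polynomial ℤ),
    (f ≠ 0 → g ≠ 0) ∧ ∀ (K : Type) [Field K], laurentHom K f =
      algebraMap (Polynomial K) (RatFunc K) (g.map (Int.castRingHom K)) * RatFunc.X ^ n := by
  obtain ⟨n, g, h⟩ := exists_T_pow f
  have hf : f = Polynomial.toLaurent g * T (-n) := by rw [h, mul_T_assoc]; simp
  refine ⟨-n, g, ?_, fun K _ => by rw [← laurentHom_toLaurent, ← laurentHom_T, ← map_mul, ← hf]⟩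
  rintro h0 rfl
  exact h0 (by rw [hf, map_zero, zero_mul])

theorem laurentHom_injective (K : Type) [Field K] [CharZero K] :
    Function.Injective (laurentHom K) := by
  rw [injective_iff_map_eq_zero]
  intro f h
  by_contra hf
  obtain ⟨n, g, hg, H⟩ := exists_laurentHom_eq f
  rw [H, mul_eq_zero, or_iff_left (zpow_ne_zero _ RatFunc.X_ne_zero),
    FaithfulSMul.algebraMap_eq_zero_iff,
    Polynomial.map_eq_zero_iff (RingHom.injective_int (Int.castRingHom K))] at h
  exact hg hf h

theorem polyWidth_map (K : Type*) [Field K] {g : Polynomial ℤ}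
    (h1 : (g.leadingCoeff : K) ≠ 0) (h2 : (g.trailingCoeff : K) ≠ 0) :
    polyWidth (g.map (Int.castRingHom K)) = g.natDegree - g.natTrailingDegree := by
  have h3 : g.map (Int.castRingHom K) ≠ 0 := by
    intro h
    have := congrArg (fun q => q.coeff g.natDegree) h
    exact h1 (by simpa using this)
  rw [polyWidth, Polynomial.natDegree_map_of_leadingCoeff_ne_zero _ h1]
  congr 2
  refine le_antisymm (Polynomial.natTrailingDegree_le_of_ne_zero 
    (by rw [Polynomial.coeff_map]; exact h2)) ?_
  refine Polynomial.le_natTrailingDegree h3 fun k hk => ?_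
  rw [Polynomial.coeff_map, Polynomial.coeff_eq_zero_of_lt_natTrailingDegree hk, map_zero]

/-- For all but finitely many primes the width of an integral Laurent polynomial does not change
under reduction. -/
theorem exists_finset_width_laurentHom_eq {f : ℤ[T;T⁻¹]} (hf : f ≠ 0) :
    ∃ S : Finset ℕ, ∀ (ℓ : ℕ) [Fact ℓ.Prime], ℓ ∉ S → laurentHom (ZMod ℓ) f ≠ 0 ∧
      width (laurentHom (ZMod ℓ) f) = width (laurentHom ℂ f) := by
  obtain ⟨n, g, hg, H⟩ := exists_laurentHom_eq f
  replace hg := hg hf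
  have hl : g.leadingCoeff ≠ 0 := Polynomial.leadingCoeff_ne_zero.2 hg
  have ht : g.trailingCoeff ≠ 0 := Polynomial.trailingCoeff_nonzero_iff_nonzero.2 hg
  -- The width survives reduction as soon as both extremal coefficients do.
  refine ⟨(g.leadingCoeff * g.trailingCoeff).natAbs.primeFactors, fun ℓ hℓ hS => ?_⟩
  have hdvd : ¬ (ℓ : ℤ) ∣ g.leadingCoeff * g.trailingCoeff := by
    intro h
    refine hS (Nat.mem_primeFactors.2 ⟨hℓ.out, Int.natCast_dvd.1 h, ?_⟩)
    exact Int.natAbs_ne_zero.2 (mul_ne_zero hl ht)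
  have key : ∀ (K : Type) [Field K], (g.leadingCoeff : K) ≠ 0 → (g.trailingCoeff : K) ≠ 0 →
      laurentHom K f ≠ 0 ∧ width (laurentHom K f) = g.natDegree - g.natTrailingDegree := by
    intro K _ h1 h2
    have h3 : algebraMap (Polynomial K) (RatFunc K) (g.map (Int.castRingHom K)) ≠ 0 := by
      rw [Ne, FaithfulSMul.algebraMap_eq_zero_iff]
      intro h
      have := congrArg (fun q => q.coeff g.natDegree) h
      exact h1 (by simpa using this)
    rw [H]
    refine ⟨mul_ne_zero h3 (zpow_ne_zero _ RatFunc.X_ne_zero), ?_⟩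
    rw [isAdditiveOnUnits_width _ _ h3 (zpow_ne_zero _ RatFunc.X_ne_zero), width_X_zpow,
      width_algebraMap, polyWidth_map K h1 h2, add_zero]
  obtain ⟨h1, h2⟩ := key (ZMod ℓ)
    (fun h => hdvd (((ZMod.intCast_zmod_eq_zero_iff_dvd _ _).1 h).mul_right _))
    (fun h => hdvd (((ZMod.intCast_zmod_eq_zero_iff_dvd _ _).1 h).mul_left _))
  exact ⟨h1, h2.trans (key ℂ (Int.cast_ne_zero.2 hl) (Int.cast_ne_zero.2 ht)).2.symm⟩

end Laurent

/-! ### The twisted chain complex over the integral Laurent polynomials -/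

theorem exists_forall_isEmpty_cell (N : Type*) [TopologicalSpace N] [T2Space N] [CompactSpace N]
    [CWComplex (univ : Set N)] :
    ∃ n, ∀ i, n ≤ i → IsEmpty (RelCWComplex.cell (univ : Set N) i) := by
  have := finite_cells_of_compactSpace N
  obtain ⟨n, hn⟩ := (Set.finite_range
    fun c : Σ n, RelCWComplex.cell (univ : Set N) n => c.1).bddAbove
  refine ⟨n + 1, fun i hi => ⟨fun c => ?_⟩⟩
  have : i ≤ n := hn ⟨⟨i, c⟩, rfl⟩
  omega

section Representation

variable {G : Type*} [Group G] {F A : Type*} [Field F] [AddCommGroup A] [Module F A]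

/-- The automorphism by which a group element acts. -/
def Representation.actEquiv (σ : Representation F G A) (g : G) : A ≃ₗ[F] A :=
  LinearEquiv.ofLinearMap (σ g) (σ g⁻¹)
    (by rw [← Module.End.mul_eq_comp, ← map_mul, mul_inv_cancel, map_one]; rfl)
    (by rw [← Module.End.mul_eq_comp, ← map_mul, inv_mul_cancel, map_one]; rfl)

/-- A family of group elements acts on a power of a representation. -/
def Representation.piActEquiv (σ : Representation F G A) {ι : Type*} (a : ι → G) :
    (ι → A) ≃ₗ[F] (ι → A) :=
  LinearEquiv.piCongrRight fun c => σ.actEquiv (a c)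

theorem Representation.piActEquiv_apply (σ : Representation F G A) {ι : Type*} (a : ι → G)
    (v : ι → A) : σ.piActEquiv a v = fun c => σ (a c) (v c) :=
  rfl

end Representation

/-! ### Matrices of the twisting module -/

section Twisting

open LaurentPolynomial

variable {G : Type*} [Group G] (θ : G →* Multiplicative ℤ) {V : Type*} [AddCommGroup V]
  (ρ : Representation ℤ G V) {n : ℕ} (bV : Module.Basis (Fin n) ℤ V)

/-- The matrix over `ℤ[t, t⁻¹]` by which a group element acts on the twisting module. -/
def twistingMatrix (γ : G) : Matrix (Fin n) (Fin n) ℤ[T;T⁻¹] :=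
  Matrix.of fun a b => T (θ γ).toAdd * C (LinearMap.toMatrix bV bV (ρ γ) a b)

variable (K : Type*) [Field K]

/-- The basis of the twisting module induced by an integral basis. -/
def twistingBasis : Module.Basis (Fin n) (RatFunc K) (RatFunc K ⊗[K] (K ⊗[ℤ] V)) :=
  Algebra.TensorProduct.basis (RatFunc K) (Algebra.TensorProduct.basis K bV)

theorem laurentHom_twistingMatrix (γ : G) (a b : Fin n) :
    laurentHom K (twistingMatrix θ ρ bV γ a b) = LinearMap.toMatrix (twistingBasis bV K)
      (twistingBasis bV K) (twistingModule θ (extendScalars K ρ) γ) a b := by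
  change _ = LinearMap.toMatrix _ _ ((RatFunc.X : RatFunc K) ^ (θ γ).toAdd •
    ((ρ γ).baseChange K).baseChange (RatFunc K)) a b
  rw [map_smul, twistingBasis, LinearMap.toMatrix_baseChange, LinearMap.toMatrix_baseChange]
  rw [twistingMatrix, Matrix.of_apply, map_mul, laurentHom_T, laurentHom_C]
  simp

theorem repr_twistingModule_apply (γ : G) (u : RatFunc K ⊗[K] (K ⊗[ℤ] V)) (a : Fin n) :
    (twistingBasis bV K).repr (twistingModule θ (extendScalars K ρ) γ u) a =
      ∑ b, laurentHom K (twistingMatrix θ ρ bV γ a b) * (twistingBasis bV K).repr u b := by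
  simp_rw [laurentHom_twistingMatrix]
  exact (congrFun (LinearMap.toMatrix_mulVec_repr (twistingBasis bV K) (twistingBasis bV K)
    (twistingModule θ (extendScalars K ρ) γ) u) a).symm

end Twisting

section Covering

open LaurentPolynomial

variable {N E : Type*} [TopologicalSpace N] [T2Space N] [CompactSpace N]
    [CWComplex (univ : Set N)] [TopologicalSpace E] [SimplyConnectedSpace E] {p : E → N}
    (hp : IsCoveringMap p) (e₀ : E) (θ : FundamentalGroup N (p e₀) →* Multiplicative ℤ)
    {V : Type*} [AddCommGroup V] (ρ : Representation ℤ (FundamentalGroup N (p e₀)) V)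
    {n : ℕ} (bV : Module.Basis (Fin n) ℤ V)

/-- The matrices over `ℤ[t, t⁻¹]` of the twisted boundary operators. -/
def FundamentalFamily.laurentBoundary (Φ : FundamentalFamily p) (i : ℕ) :
    Matrix (Σ _ : RelCWComplex.cell (univ : Set N) i, Fin n)
      (Σ _ : RelCWComplex.cell (univ : Set N) (i + 1), Fin n) ℤ[T;T⁻¹] :=
  Matrix.of fun k l => (Φ.boundaryEntry hp e₀ l.1 k.1).sum fun γ m =>
    m • twistingMatrix θ ρ bV γ k.2 l.2

variable (K : Type*) [Field K]

/-- The coordinates on the twisted chain modules with respect to the basis given by the cells and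
an integral basis of the representation. -/
def twistedCoordinates (N : Type*) [TopologicalSpace N] [T2Space N] [CompactSpace N]
    [CWComplex (univ : Set N)] (i : ℕ) :
    (RelCWComplex.cell (univ : Set N) i → RatFunc K ⊗[K] (K ⊗[ℤ] V)) ≃ₗ[RatFunc K]
      ((Σ _ : RelCWComplex.cell (univ : Set N) i, Fin n) → RatFunc K) :=
  (Pi.basis fun _ : RelCWComplex.cell (univ : Set N) i => twistingBasis bV K).equivFun

theorem twistedCoordinates_apply (i : ℕ)
    (v : RelCWComplex.cell (univ : Set N) i → RatFunc K ⊗[K] (K ⊗[ℤ] V))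
    (k : Σ _ : RelCWComplex.cell (univ : Set N) i, Fin n) :
    twistedCoordinates bV K N i v k = (twistingBasis bV K).repr (v k.1) k.2 :=
  Pi.basis_repr (fun _ : RelCWComplex.cell (univ : Set N) i => twistingBasis bV K) v k

theorem FundamentalFamily.twistedCoordinates_twistedBoundary (Φ : FundamentalFamily p) (i : ℕ)
    (v : RelCWComplex.cell (univ : Set N) (i + 1) → RatFunc K ⊗[K] (K ⊗[ℤ] V)) :
    twistedCoordinates bV K N i (Φ.twistedBoundary hp e₀
      (twistingModule θ (extendScalars K ρ)) i v) =
    ((Φ.laurentBoundary hp e₀ θ ρ bV i).map (laurentHom K)).mulVecLin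
      (twistedCoordinates bV K N (i + 1) v) := by
  funext ⟨k, a⟩
  rw [twistedCoordinates_apply, Matrix.mulVecLin_apply, Matrix.mulVec, dotProduct,
    Fintype.sum_sigma]
  simp only [FundamentalFamily.twistedBoundary, LinearMap.pi_apply, LinearMap.sum_apply,
    LinearMap.comp_apply, LinearMap.proj_apply, map_sum, Finsupp.finsetSum_apply]
  refine Finset.sum_congr rfl fun c _ => ?_
  simp only [twistedCoordinates_apply, Matrix.map_apply, FundamentalFamily.laurentBoundary,
    Matrix.of_apply, Finsupp.sum, LinearMap.sum_apply, map_sum, Finsupp.finsetSum_apply,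
    Finset.sum_mul]
  rw [Finset.sum_comm]
  refine Finset.sum_congr rfl fun γ _ => ?_
  rw [LinearMap.smul_apply, map_zsmul, Finsupp.smul_apply, repr_twistingModule_apply,
    Finset.smul_sum]
  refine Finset.sum_congr rfl fun b _ => ?_
  rw [map_zsmul, smul_mul_assoc]

omit [TopologicalSpace E] [SimplyConnectedSpace E] in
-- Relative to the integral basis, the new one is block diagonal over the cells. Each block is a
-- power of `t` times an automorphism defined over `K`, combining the change of basis with the
-- action of `a c`.
theorem width_det_twistedCoordinates {r : ℕ} (i : ℕ)
    [DecidableEq (Σ _ : RelCWComplex.cell (univ : Set N) i, Fin r)]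
    (b : Module.Basis (Fin r) K (K ⊗[ℤ] V)) (bV : Module.Basis (Fin r) ℤ V)
    (a : RelCWComplex.cell (univ : Set N) i → FundamentalGroup N (p e₀)) :
    width ((Pi.basisFun (RatFunc K) (Σ _ : RelCWComplex.cell (univ : Set N) i, Fin r)).det
      ((Pi.basis fun _ : RelCWComplex.cell (univ : Set N) i =>
        Algebra.TensorProduct.basis (RatFunc K) b).map
        (((twistingModule θ (extendScalars K ρ)).piActEquiv a).trans
          (twistedCoordinates bV K N i)))) = 0 := by
  classical
  have hfin : Module.Finite K (K ⊗[ℤ] V) := Module.Finite.of_basis b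
  let b₀ := Algebra.TensorProduct.basis K bV
  let g : RelCWComplex.cell (univ : Set N) i → ((K ⊗[ℤ] V) ≃ₗ[K] (K ⊗[ℤ] V)) := fun c =>
    (b₀.equiv b (Equiv.refl _)).trans ((extendScalars K ρ).actEquiv (a c))
  let f : RelCWComplex.cell (univ : Set N) i →
      (RatFunc K ⊗[K] (K ⊗[ℤ] V)) →ₗ[RatFunc K] (RatFunc K ⊗[K] (K ⊗[ℤ] V)) := fun c =>
    (RatFunc.X : RatFunc K) ^ (θ (a c)).toAdd • (g c : (K ⊗[ℤ] V) →ₗ[K] _).baseChange (RatFunc K)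
  let B := Pi.basis fun _ : RelCWComplex.cell (univ : Set N) i => twistingBasis bV K
  have hf : ∀ c j, f c (twistingBasis bV K j) = twistingModule θ (extendScalars K ρ) (a c)
      (Algebra.TensorProduct.basis (RatFunc K) b j) := by
    intro c j
    change (RatFunc.X : RatFunc K) ^ (θ (a c)).toAdd • (g c : (K ⊗[ℤ] V) →ₗ[K] _).baseChange
      (RatFunc K) _ = (RatFunc.X : RatFunc K) ^ (θ (a c)).toAdd •
      ((extendScalars K ρ) (a c)).baseChange (RatFunc K) _
    rw [twistingBasis, Algebra.TensorProduct.basis_apply (A := RatFunc K),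
      Algebra.TensorProduct.basis_apply (A := RatFunc K),
      LinearMap.baseChange_tmul, LinearMap.baseChange_tmul]
    congr 2
    change (extendScalars K ρ) (a c) (b₀.equiv b (Equiv.refl _) (b₀ j)) = _
    rw [Module.Basis.equiv_apply, Equiv.refl_apply]
  have hdet : (Pi.basisFun (RatFunc K) (Σ _ : RelCWComplex.cell (univ : Set N) i, Fin r)).det
      ((Pi.basis fun _ : RelCWComplex.cell (univ : Set N) i =>
        Algebra.TensorProduct.basis (RatFunc K) b).map
        (((twistingModule θ (extendScalars K ρ)).piActEquiv a).trans
          (twistedCoordinates bV K N i))) =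
      B.det (LinearMap.pi (fun c => (f c).comp (LinearMap.proj c)) ∘ B) := by
    rw [Module.Basis.det_apply, Module.Basis.det_apply]
    congr 1
    ext k l
    rw [Module.Basis.toMatrix_apply, Module.Basis.toMatrix_apply, Pi.basisFun_repr,
      Module.Basis.map_apply, LinearEquiv.trans_apply]
    change B.repr _ k = _
    congr 2
    funext c
    change twistingModule θ (extendScalars K ρ) (a c)
      (Pi.basis (fun _ => Algebra.TensorProduct.basis (RatFunc K) b) l c) =
        f c (Pi.basis (fun _ => twistingBasis bV K) l c)
    rw [Pi.basis_apply, Pi.basis_apply]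
    by_cases hc : c = l.1
    · subst hc
      rw [Pi.single_eq_same, Pi.single_eq_same, hf]
    · rw [Pi.single_eq_of_ne hc, Pi.single_eq_of_ne hc, map_zero, map_zero]
  rw [hdet, Module.Basis.det_comp, Module.Basis.det_self, mul_one, LinearMap.det_pi,
    isAdditiveOnUnits_width.prod _ _ fun c _ => (width_det_smul_baseChange (g c) _).1]
  exact Finset.sum_eq_zero fun c _ => (width_det_smul_baseChange (g c) _).2

theorem FundamentalFamily.twistedCoordinates_piActEquiv (Φ : FundamentalFamily p)
    {Ψ : FundamentalFamily p} {g : ∀ m, RelCWComplex.cell (univ : Set N) m → Deck p}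
    (hg : ∀ m c, ∀ x ∈ closedBall (0 : Fin m → ℝ) 1, Ψ.lift m c x = (g m c).1 (Φ.lift m c x))
    (i : ℕ) (v : RelCWComplex.cell (univ : Set N) (i + 1) → RatFunc K ⊗[K] (K ⊗[ℤ] V)) :
    (((twistingModule θ (extendScalars K ρ)).piActEquiv fun c => deckLoop hp e₀ (g i c)).trans
      (twistedCoordinates bV K N i))
        (Ψ.twistedBoundary hp e₀ (twistingModule θ (extendScalars K ρ)) i v) =
    ((Φ.laurentBoundary hp e₀ θ ρ bV i).map (laurentHom K)).mulVecLin
      ((((twistingModule θ (extendScalars K ρ)).piActEquiv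
        fun c => deckLoop hp e₀ (g (i + 1) c)).trans (twistedCoordinates bV K N (i + 1))) v) := by
  rw [LinearEquiv.trans_apply, LinearEquiv.trans_apply,
    ← FundamentalFamily.twistedCoordinates_twistedBoundary,
    Representation.piActEquiv_apply, Representation.piActEquiv_apply,
    FundamentalFamily.twistedBoundary_eq hg hp e₀ (twistingModule θ (extendScalars K ρ)) i v]

/-- The width of the twisted torsion can be computed from the matrices over `ℤ[t, t⁻¹]` given by
one fixed fundamental family and one fixed integral basis. -/
theorem IsTwistedTorsion.exists_isTorsionOfComplex [LocallyPathConnectedSpace N]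
    (Φ : FundamentalFamily p) (bV : Module.Basis (Fin n) ℤ V) {τ : RatFunc K}
    (h : IsTwistedTorsion hp e₀ θ (extendScalars K ρ) τ) :
    ∃ τ₀, IsTorsionOfComplex
      (fun i => Pi.basisFun (RatFunc K) (Σ _ : RelCWComplex.cell (univ : Set N) i, Fin n))
      (fun i => ((Φ.laurentBoundary hp e₀ θ ρ bV i).map (laurentHom K)).mulVecLin) τ₀ ∧
      width τ₀ = width τ := by
  have := hp.locallyPathConnectedSpace
  obtain ⟨Ψ, r, b, hτ⟩ := h
  obtain rfl : n = r := by
    rw [← Fintype.card_fin n, ← Fintype.card_fin r,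
      ← Module.finrank_eq_card_basis (Algebra.TensorProduct.basis K bV),
      ← Module.finrank_eq_card_basis b]
  choose g hg using fun m (c : RelCWComplex.cell (univ : Set N) m) => Φ.exists_deck hp Ψ m c
  -- The complex of `Ψ` is moved to that of `Φ` by the loops relating the lifts, then to
  -- coordinates. This leaves the torsion unchanged and only replaces the bases.
  have he := hτ.map (fun i => ((twistingModule θ (extendScalars K ρ)).piActEquiv
      fun c => deckLoop hp e₀ (g i c)).trans (twistedCoordinates bV K N i))
    (Φ.twistedCoordinates_piActEquiv hp e₀ θ ρ bV K hg)
  obtain ⟨τ₀, hτ₀⟩ := _root_.exists_isTorsionOfComplex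
    (fun i => Pi.basisFun (RatFunc K) (Σ _ : RelCWComplex.cell (univ : Set N) i, Fin n))
    (fun i => ((Φ.laurentBoundary hp e₀ θ ρ bV i).map (laurentHom K)).mulVecLin)
  obtain ⟨m, hm⟩ := exists_forall_isEmpty_cell N
  refine ⟨τ₀, hτ₀, isAdditiveOnUnits_width.isTorsionOfComplex_unique
    (fun i => @width_det_twistedCoordinates N E _ _ _ _ p e₀ θ V _ ρ K _ n i
      (fun _ _ => Classical.propDecidable _) b bV _) (n := m) (fun i hi => ?_) hτ₀ he⟩
  have := hm i hi
  infer_instance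

end Covering

end

/-! ### The theorem -/

theorem lemma4 {N : Type*} [TopologicalSpace N] [ChartedSpace (EuclideanHalfSpace 3) N]
    [IsManifold (𝓡∂ 3) ∞ N] [T2Space N] [SecondCountableTopology N] [CompactSpace N]
    [ConnectedSpace N] (hor : IsOrientableThreeManifold N) (htor : HasToroidalBoundary N)
    [CWComplex (univ : Set N)]
    {E : Type*} [TopologicalSpace E] [SimplyConnectedSpace E] {p : E → N}
    (hp : IsCoveringMap p) (e₀ : E)
    (θ : FundamentalGroup N (p e₀) →* Multiplicative ℤ) (hθ : θ ≠ 1)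
    {V : Type*} [AddCommGroup V] [Module.Free ℤ V] [Module.Finite ℤ V]
    (ρ : Representation ℤ (FundamentalGroup N (p e₀)) V) :
    ∃ S : Finset ℕ, ∀ (ℓ : ℕ) [Fact ℓ.Prime], ℓ ∉ S →
      ∀ (τℓ : RatFunc (ZMod ℓ)) (τ : RatFunc ℂ),
        IsTwistedTorsion hp e₀ θ (extendScalars (ZMod ℓ) ρ) τℓ →
        IsTwistedTorsion hp e₀ θ (extendScalars ℂ ρ) τ →
        width τℓ = width τ := by
  classical
  have hloc : LocallyPathConnectedSpace N :=
    ChartedSpace.locallyPathConnectedSpace (EuclideanHalfSpace 3) N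
  have : PathConnectedSpace N := .of_locallyPathConnectedSpace
  have : Nonempty E := ⟨e₀⟩
  obtain ⟨Φ⟩ := nonempty_fundamentalFamily hp
  obtain ⟨m, hm⟩ := exists_forall_isEmpty_cell N
  let bV := Module.finBasis ℤ V
  obtain ⟨B, hB, H⟩ := exists_finset_forall_isTorsionOfComplex_eq
    (κ := fun i => Σ _ : RelCWComplex.cell (univ : Set N) i, Fin (Module.finrank ℤ V))
    (Φ.laurentBoundary hp e₀ θ ρ bV) (n := m)
    (fun i hi => by have := hm i hi; infer_instance) (laurentHom_injective ℂ)
    isAdditiveOnUnits_width width_zero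
  -- Each of the finitely many ring elements in `B` excludes finitely many primes.
  choose S hS using fun b : B => exists_finset_width_laurentHom_eq (hB b b.2)
  refine ⟨Finset.univ.biUnion S, fun ℓ _ hℓ τℓ τ hτℓ hτ => ?_⟩
  obtain ⟨σℓ, hσℓ, hwℓ⟩ := hτℓ.exists_isTorsionOfComplex hp e₀ θ ρ _ Φ bV
  obtain ⟨σ, hσ, hw⟩ := hτ.exists_isTorsionOfComplex hp e₀ θ ρ _ Φ bV
  rw [← hwℓ, ← hw]
  refine H (laurentHom (ZMod ℓ)) isAdditiveOnUnits_width width_zero (fun b hb => ?_) hσ hσℓ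
  exact hS ⟨b, hb⟩ ℓ fun h => hℓ (Finset.mem_biUnion.2 ⟨⟨b, hb⟩, Finset.mem_univ _, h⟩)
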